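/- **Theorem 1.4.** Let $X$ be an infinite-dimensional, uniformly convex real Banach space whose norm is $C^1$ on $X\setminus\{0\}$, and let $S$ be its unit sphere. Let $I_1,I_2\in C^1(X,\mathbb R)$ be even, with $I_2(u)\neq0$ for all $u\ne0$. For $c\in\mathbb R$, $u\in X\setminus\{0\}$ and $s>0$ set $$\mu(c,u)=\frac{I_1(u)-c}{I_2(u)},\qquad \psi_{c,u}(s)=\mu(c,su).$$ Let $\mathcal I\subset\mathbb R$ be an open set such that **(H1)** the map $(c,u,s)\mapsto\psi_{c,u}'(s)$ is $C^1$ on $\mathcal I\times(X\setminus\{0\})\times(0,\infty)$; and either for every $(c,u)\in\mathcal I\times(X\setminus\{0\})$ the map $\psi_{c,u}$ has exactly one local minimizer of Morse type (i.e. with $\psi_{c,u}''\neq0$ there) in $(0,\infty)$, or for every such $(c,u)$ it has exactly one local maximizer of Morse type in $(0,\infty)$. Denote this point by $t(c,u)$ (if both alternatives hold, fix one of them). Put $\Lambda(c,u)=\psi_{c,u}(t(c,u))$ for $(c,u)\in\mathcal I\times(X\setminus\{0\})$, and let $\widetilde\Lambda$ be the restriction of $\Lambda$ to $\mathcal I\times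 S$, so that $\frac{\partial\widetilde\Lambda}{\partial u}(c,u)$ is the restriction of $\frac{\partial\Lambda}{\partial u}(c,u)$ to the tangent space of $S$ at $u$. For a nonempty closed symmetric set $F\subset S$ let the genus $\gamma(F)$ be the least $k\in\mathbb N$ for which there is an odd continuous map $F\to\mathbb R^k\setminus\{0\}$ ($\gamma(F)=\infty$ if there is none), and let $$\mathcal F_n=\{F\subset S:\ F\text{ nonempty, compact, symmetric},\ \gamma(F)\ge n\}.$$ Assume **(PSG)** if $c_k\to c\in\mathcal I$ with $c_k\in\mathcal I$, and $u_k\in S$ are such that $(\Lambda(c_k,u_k))$ is bounded and $\frac{\partial\widetilde\Lambda}{\partial u}(c_k,u_k)\to0$ (in dual norm), then $(u_k)$ has a convergent subsequence, and one of the following two groups of conditions. *First case.* Put $\mu_{n,c}=\inf_{F\in\mathcal F_n}\sup_{u\in F}\Lambda(c,u)$. * **(H2)** For every $c\in\mathcal I$, $\widetilde\Lambda(c,\cdot)$ is bounded from below, and for every $n\in\mathbb N$ it satisfies the Palais–Smale condition at the level $\mu_{n,c}$: every sequence $(u_k)\subset S$ with $\widetilde\Lambda(c,u_k)\to\mu_{n,c}$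 and $\frac{\partial\widetilde\Lambda}{\partial u}(c,u_k)\to0$ has a convergent subsequence. * **(H3)** For every $u\in S$ the map $c\mapsto\Lambda(c,u)$ is strictly decreasing in $\mathcal I$; $\Lambda$ is bounded from above on every compact set $K\subset\mathcal I\times S$; and whenever $\Lambda$ is bounded on a set $[a,b]\times S_0\subset\mathcal I\times S$, the derivative $\frac{\partial\Lambda}{\partial c}$ is bounded and bounded away from zero on that set. *Second case.* Put $\mu_{n,c}=\sup_{F\in\mathcal F_n}\inf_{u\in F}\Lambda(c,u)$, and assume (H2) with "bounded from above" instead of "bounded from below" and (H3) with "strictly increasing" and "bounded from below" instead of "strictly decreasing" and "bounded from above", respectively. Then for every $n\in\mathbb N$ the map $c\mapsto\mu_{n,c}$ is locally Lipschitz continuous on $\mathcal I$, and it is strictly decreasing on $\mathcal I$ in the first case and strictly increasing on $\mathcal I$ in the second case. -/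

import Mathlib

open Set Filter Topology

noncomputable section

namespace EnergyCurves

variable {X : Type*} [NormedAddCommGroup X] [NormedSpace ℝ X]

/-- The value `μ(c,u) = (I₁(u) - c) / I₂(u)` solving `I₁(u) - μ I₂(u) = c` for `μ`. -/
def mu (I₁ I₂ : X → ℝ) (c : ℝ) (u : X) : ℝ := (I₁ u - c) / I₂ u

/-- The fibering map `ψ_{c,u}(s) = μ(c, s u)`; it is only looked at for `s > 0`. -/
def psi (I₁ I₂ : X → ℝ) (c : ℝ) (u : X) (s : ℝ) : ℝ := mu I₁ I₂ c (s • u)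

/-- `s > 0` is a local minimizer of `f` of Morse type (that is, nondegenerate). -/
def IsMorseMin (f : ℝ → ℝ) (s : ℝ) : Prop :=
  0 < s ∧ IsLocalMin f s ∧ deriv (deriv f) s ≠ 0

/-- `s > 0` is a local maximizer of `f` of Morse type (that is, nondegenerate). -/
def IsMorseMax (f : ℝ → ℝ) (s : ℝ) : Prop :=
  0 < s ∧ IsLocalMax f s ∧ deriv (deriv f) s ≠ 0

/-- Condition (H1) on the open set `I`, where `t(c,u)` denotes the point it provides:
either `t(c,u)` is the one and only local minimizer of Morse type of `ψ_{c,u}` for all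
`(c,u) ∈ I × (X \ {0})`, or it is the one and only local maximizer of Morse type for all such
`(c,u)`. Values of `t` outside `I × (X \ {0})` play no role. -/
structure H1 (I₁ I₂ : X → ℝ) (I : Set ℝ) (t : ℝ → X → ℝ) : Prop where
  isOpen : IsOpen I
  contDiffOn : ContDiffOn ℝ 1 (fun p : ℝ × X × ℝ => deriv (psi I₁ I₂ p.1 p.2.1) p.2.2)
    (I ×ˢ ({0}ᶜ : Set X) ×ˢ Ioi (0 : ℝ))
  extremum :
    (∀ c ∈ I, ∀ u : X, u ≠ 0 → ∀ s : ℝ, IsMorseMin (psi I₁ I₂ c u) s ↔ s = t c u) ∨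
    (∀ c ∈ I, ∀ u : X, u ≠ 0 → ∀ s : ℝ, IsMorseMax (psi I₁ I₂ c u) s ↔ s = t c u)

/-- The reduced functional `Λ(c,u) = ψ_{c,u}(t(c,u)) = μ(c, t(c,u) u)`. -/
def Lam (I₁ I₂ : X → ℝ) (t : ℝ → X → ℝ) (c : ℝ) (u : X) : ℝ := psi I₁ I₂ c u (t c u)

/-- The unit sphere of `X`. -/
def unitSphere (X : Type*) [NormedAddCommGroup X] : Set X := Metric.sphere (0 : X) 1

/-- The tangent space `{v | i'(u) v = 0}` to the unit sphere at `u`, with `i(u) = ‖u‖² / 2`. -/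
def tangentSphere (u : X) : Submodule ℝ X :=
  LinearMap.ker (fderiv ℝ (fun v : X => (1 / 2 : ℝ) * ‖v‖ ^ 2) u).toLinearMap

/-- The derivative at `u` of the restriction to the unit sphere of a functional `f`, as a bounded
linear functional on the tangent space to the sphere at `u`. -/
def sphereDeriv (f : X → ℝ) (u : X) : tangentSphere u →L[ℝ] ℝ :=
  (fderiv ℝ f u).comp (tangentSphere u).subtypeL

/-- The Krasnoselskii genus: the least `k` such that there is an odd continuous map
`F → ℝᵏ \ {0}`, and `⊤` if there is no such `k`. -/
def genus (F : Set X) : ℕ∞ :=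
  sInf {m : ℕ∞ | ∃ k : ℕ, m = k ∧ ∃ h : X → EuclideanSpace ℝ (Fin k),
    ContinuousOn h F ∧ (∀ x ∈ F, h x ≠ 0) ∧ ∀ x ∈ F, h (-x) = -h x}

/-- The family `𝓕_n` of nonempty compact symmetric subsets of the unit sphere of genus `≥ n`. -/
def genusFamily (X : Type*) [NormedAddCommGroup X] [NormedSpace ℝ X] (n : ℕ) : Set (Set X) :=
  {F | F ⊆ unitSphere X ∧ F.Nonempty ∧ IsCompact F ∧ (∀ x ∈ F, -x ∈ F) ∧ (n : ℕ∞) ≤ genus F}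

/-- `inf_{F ∈ 𝓕_n} sup_{u ∈ F} f(u)`. -/
def minimax (n : ℕ) (f : X → ℝ) : ℝ := sInf ((fun F : Set X => sSup (f '' F)) '' genusFamily X n)

/-- `sup_{F ∈ 𝓕_n} inf_{u ∈ F} f(u)`. -/
def maximin (n : ℕ) (f : X → ℝ) : ℝ := sSup ((fun F : Set X => sInf (f '' F)) '' genusFamily X n)

/-- The sequence `w` has a convergent subsequence. -/
def HasConvergentSubseq (w : ℕ → X) : Prop :=
  ∃ (x : X) (φ : ℕ → ℕ), StrictMono φ ∧ Tendsto (w ∘ φ) atTop (𝓝 x)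

/-- The Palais–Smale condition at the level `l` for the restriction of `f` to the unit sphere. -/
def PalaisSmaleAt (f : X → ℝ) (l : ℝ) : Prop :=
  ∀ w : ℕ → X, (∀ k, w k ∈ unitSphere X) → Tendsto (fun k => f (w k)) atTop (𝓝 l) →
    Tendsto (fun k => ‖sphereDeriv f (w k)‖) atTop (𝓝 0) → HasConvergentSubseq w

/-- Condition (H2), first alternative, for the functional `Λ`: boundedness from below on the
sphere and Palais–Smale at the levels `inf sup`. -/
def H2Below (I : Set ℝ) (L : ℝ → X → ℝ) : Prop :=
  ∀ c ∈ I, BddBelow (L c '' unitSphere X) ∧ ∀ n : ℕ, PalaisSmaleAt (L c) (minimax n (L c))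

/-- Condition (H2), second alternative: boundedness from above on the sphere and Palais–Smale
at the levels `sup inf`. -/
def H2Above (I : Set ℝ) (L : ℝ → X → ℝ) : Prop :=
  ∀ c ∈ I, BddAbove (L c '' unitSphere X) ∧ ∀ n : ℕ, PalaisSmaleAt (L c) (maximin n (L c))

/-- If `Λ` is bounded in `[a,b] × S₀ ⊆ I × S` then `∂Λ/∂c` is bounded and away from zero there. -/
def PartialBound (I : Set ℝ) (L : ℝ → X → ℝ) : Prop :=
  ∀ (a b : ℝ) (S₀ : Set X), Icc a b ⊆ I → S₀ ⊆ unitSphere X →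
    (∃ C : ℝ, ∀ c ∈ Icc a b, ∀ u ∈ S₀, |L c u| ≤ C) →
    ∃ m M : ℝ, 0 < m ∧ ∀ c ∈ Icc a b, ∀ u ∈ S₀,
      m ≤ |deriv (fun s => L s u) c| ∧ |deriv (fun s => L s u) c| ≤ M

/-- Condition (H3), first alternative. -/
structure H3Decreasing (I : Set ℝ) (L : ℝ → X → ℝ) : Prop where
  decreasing : ∀ u ∈ unitSphere X, StrictAntiOn (fun c => L c u) I
  bddAbove : ∀ K : Set (ℝ × X), K ⊆ I ×ˢ unitSphere X → IsCompact K →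
    BddAbove ((fun p : ℝ × X => L p.1 p.2) '' K)
  partialBound : PartialBound I L

/-- Condition (H3), second alternative. -/
structure H3Increasing (I : Set ℝ) (L : ℝ → X → ℝ) : Prop where
  increasing : ∀ u ∈ unitSphere X, StrictMonoOn (fun c => L c u) I
  bddBelow : ∀ K : Set (ℝ × X), K ⊆ I ×ˢ unitSphere X → IsCompact K →
    BddBelow ((fun p : ℝ × X => L p.1 p.2) '' K)
  partialBound : PartialBound I L

/-- The generalized Palais–Smale condition (PSG). -/
def PSG (I : Set ℝ) (L : ℝ → X → ℝ) : Prop :=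
  ∀ (c : ℝ) (cs : ℕ → ℝ) (w : ℕ → X), c ∈ I → (∀ k, cs k ∈ I) → Tendsto cs atTop (𝓝 c) →
    (∀ k, w k ∈ unitSphere X) → (∃ C : ℝ, ∀ k, |L (cs k) (w k)| ≤ C) →
    Tendsto (fun k => ‖sphereDeriv (L (cs k)) (w k)‖) atTop (𝓝 0) → HasConvergentSubseq w

end EnergyCurves

end

/-! By the implicit function theorem at the nondegenerate extremum, `Lam` is C¹ in (c,u); uniqueness
of the extremum makes it even and 0-homogeneous in u (`isSphericalFamily_Lam`). Everything else uses
only these properties, and the second case is the first one for −Λ.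

Strict monotonicity: almost optimal sets for c lie in a sublevel set of Λ(c,·). On it Λ is bounded
over [c,c'], so (H3) bounds ∂Λ/∂c away from zero, and the mean value theorem lowers Λ uniformly.

Lipschitz continuity needs control in the other direction, from c₂ down to c₁ < c₂, where a bound on
Λ(c₂,·) gives no evident bound on Λ(c₁,·). By (PSG), near a given parameter and below a given level,
either the spherical gradient is at least ε or |∂Λ/∂c| is at most M (`exists_bound_or_gradient`). In
the first case one can descend in u while barely moving c; in the second, lowering c costs at most M
per unit. Both moves decrease Λ + (M+1)c, so a continuous equivariant descent in (c,u) carries a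
compact symmetric set from c₂ to c₁ without lowering its genus below n
(`exists_mem_genusFamily_transfer`). Hence μ(c₁) ≤ μ(c₂) + (M+1)(c₂ − c₁).

The families 𝓕_n must be nonempty, which is Borsuk–Ulam. It is proved algebraically: an odd map is
approximated by polynomials, their odd parts become a system xᵢ^d + δgᵢ(x) = 0 with d odd, and the
quotient algebra of dimension dⁿ, being odd, has a real point. -/

/-! ### Real points of algebras of odd dimension -/

/-- A finite-dimensional commutative real algebra of odd dimension has a real point. -/
theorem exists_algHom_real_of_odd_finrank (Q : Type*) [CommRing Q] [Algebra ℝ Q]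
    [Module.Finite ℝ Q] (hodd : Odd (Module.finrank ℝ Q)) : Nonempty (Q →ₐ[ℝ] ℝ) := by
  by_contra hne
  have hN : IsNoetherianRing Q := IsNoetherianRing.of_finite ℝ Q
  -- Filter Q by modules Q/𝔭. Each residue field is ℝ or ℂ; without a real point only ℂ occurs, so
  -- the dimension is even. The real structure is restricted from Q because the induction principle
  -- sees only Q-modules.
  have key : Even (@Module.finrank ℝ Q _ _ (Module.compHom Q (algebraMap ℝ Q))) := by
    refine IsNoetherianRing.induction_on_isQuotientEquivQuotientPrime Q (M := Q) inferInstance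
      (motive := fun N _ _ _ => Even (@Module.finrank ℝ N _ _ (Module.compHom N (algebraMap ℝ Q))))
      ?_ ?_ ?_
    · intro N _ _ _ hs
      let _ : Module ℝ N := Module.compHom N (algebraMap ℝ Q)
      rw [Module.finrank_zero_of_subsingleton]
      exact Even.zero
    · intro N _ _ _ p e
      let _ : Module ℝ N := Module.compHom N (algebraMap ℝ Q)
      have hp : p.1.IsMaximal := by
        have : IsArtinianRing Q := IsArtinianRing.of_finite ℝ Q
        exact IsArtinianRing.isMaximal_of_isPrime p.1
      let _ : Field (Q ⧸ p.1) := Ideal.Quotient.field p.1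
      let e' : N ≃ₗ[ℝ] (Q ⧸ p.1) :=
        { e with
          map_smul' := fun r x =>
            (e.map_smul (algebraMap ℝ Q r) x).trans (algebraMap_smul Q r (e x)) }
      rw [e'.finrank_eq]
      have : Algebra.IsAlgebraic ℝ (Q ⧸ p.1) := Algebra.IsAlgebraic.of_finite ℝ _
      rcases Real.nonempty_algEquiv_or (Q ⧸ p.1) with ⟨⟨g⟩⟩ | ⟨⟨g⟩⟩
      · exact absurd ⟨(g.toAlgHom).comp (Ideal.Quotient.mkₐ ℝ p.1)⟩ hne
      · rw [g.toLinearEquiv.finrank_eq, Complex.finrank_real_complex]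
        exact even_two
    · intro N₁ _ _ _ N₂ _ _ _ N₃ _ _ _ f g hf hg hfg h1 h3
      let _ : Module ℝ N₁ := Module.compHom N₁ (algebraMap ℝ Q)
      let _ : Module ℝ N₂ := Module.compHom N₂ (algebraMap ℝ Q)
      let _ : Module ℝ N₃ := Module.compHom N₃ (algebraMap ℝ Q)
      let f' : N₁ →ₗ[ℝ] N₂ := { f with map_smul' := fun r x => f.map_smul (algebraMap ℝ Q r) x }
      let g' : N₂ →ₗ[ℝ] N₃ := { g with map_smul' := fun r x => g.map_smul (algebraMap ℝ Q r) x }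
      have hst : IsScalarTower ℝ Q N₂ :=
        ⟨fun r q x => by rw [Algebra.smul_def, mul_smul]; rfl⟩
      have fin2 : Module.Finite ℝ N₂ := Module.Finite.trans Q _
      have h := LinearMap.finrank_range_add_finrank_ker g'
      have hr : LinearMap.range g' = ⊤ := LinearMap.range_eq_top.2 hg
      have hk : LinearMap.ker g' = LinearMap.range f' := by
        ext x
        exact hfg x
      rw [hr, finrank_top, hk, LinearMap.finrank_range_of_inj (f := f') hf] at h
      rw [← h]
      exact h3.add h1
  have : Module.compHom Q (algebraMap ℝ Q) = (Algebra.toModule : Module ℝ Q) := by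
    ext r x
    exact (Algebra.smul_def r x).symm
  rw [this] at key
  exact (Nat.not_even_iff_odd.2 hodd) key

/-! ### Generic systems xᵢ^d + δgᵢ and the dimension of their quotient algebras -/

namespace MvPolynomial

variable {n : ℕ}

/-- The linear endomorphism sending the monomial with exponent `d • b + a`, `a < d`, to
`X ^ a * f ^ b`. -/
noncomputable def substPow {A : Type*} [CommRing A] (d : ℕ) (f : Fin n → MvPolynomial (Fin n) A) :
    MvPolynomial (Fin n) A →ₗ[A] MvPolynomial (Fin n) A :=
  (basisMonomials (Fin n) A).constr A
    (fun m => ∏ i, (X i ^ (m i % d) * f i ^ (m i / d)))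

section substPow

variable {A B : Type*} [CommRing A] [CommRing B] (d : ℕ) (f : Fin n → MvPolynomial (Fin n) A)

theorem substPow_monomial (m : Fin n →₀ ℕ) :
    substPow d f (monomial m 1) = ∏ i, (X i ^ (m i % d) * f i ^ (m i / d)) := by
  have := (basisMonomials (Fin n) A).constr_basis A
    (fun m => ∏ i, (X i ^ (m i % d) * f i ^ (m i / d))) m
  simpa [substPow] using this

theorem monomial_one_eq_prod (m : Fin n →₀ ℕ) :
    (monomial m (1 : A)) = ∏ i, X i ^ m i := by
  rw [monomial_eq, Finsupp.prod_fintype _ _ (fun i => pow_zero _)]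
  simp

/-- This is the value δ = 0 of the perturbation, where the determinants below equal 1. -/
theorem substPow_X_pow (m : Fin n →₀ ℕ) :
    substPow d (fun i => X i ^ d) (monomial m (1 : A)) = monomial m 1 := by
  rw [substPow_monomial, monomial_one_eq_prod]
  refine Finset.prod_congr rfl fun i _ => ?_
  rw [← pow_mul, ← pow_add, Nat.mod_add_div]

theorem map_substPow_monomial (φ : A →+* B) (m : Fin n →₀ ℕ) :
    map φ (substPow d f (monomial m 1)) =
      substPow d (fun i => map φ (f i)) (monomial m 1) := by
  simp [substPow_monomial, map_prod]

theorem totalDegree_substPow_monomial_le (hf : ∀ i, (f i).totalDegree ≤ d) (m : Fin n →₀ ℕ) :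
    (substPow d f (monomial m 1)).totalDegree ≤ m.degree := by
  rw [substPow_monomial, Finsupp.degree_eq_sum]
  refine (totalDegree_finsetProd _ _).trans (Finset.sum_le_sum fun i _ => ?_)
  refine (totalDegree_mul _ _).trans ?_
  calc _ ≤ m i % d + (m i / d) * d := by
        refine Nat.add_le_add ?_ ((totalDegree_pow _ _).trans (Nat.mul_le_mul_left _ (hf i)))
        rcases subsingleton_or_nontrivial A with h | h
        · rw [Subsingleton.elim (X i ^ (m i % d) : MvPolynomial (Fin n) A) 0]
          simp
        · rw [totalDegree_X_pow]
    _ = m i := by rw [mul_comm, Nat.mod_add_div]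

/-- Raising the i-th exponent by d keeps its remainder and adds one to its quotient. Thus `substPow`
carries the ideal of the powers `X i ^ d` to the ideal of the `f i`. -/
theorem substPow_X_pow_mul (hd : 0 < d) (i : Fin n) (p : MvPolynomial (Fin n) A) :
    substPow d f (X i ^ d * p) = f i * substPow d f p := by
  have : (substPow d f) ∘ₗ (LinearMap.mulLeft A (X i ^ d)) =
      (LinearMap.mulLeft A (f i)) ∘ₗ (substPow d f) := by
    refine (basisMonomials (Fin n) A).ext fun m => ?_
    have hm : (X i ^ d * monomial m 1 : MvPolynomial (Fin n) A) =
        monomial (Finsupp.single i d + m) 1 := by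
      rw [X_pow_eq_monomial, monomial_mul, one_mul]
    simp only [coe_basisMonomials, LinearMap.comp_apply, LinearMap.mulLeft_apply]
    rw [hm, substPow_monomial, substPow_monomial, ← Finset.mul_prod_erase _ _ (Finset.mem_univ i),
      ← Finset.mul_prod_erase _ (fun j => X j ^ (m j % d) * f j ^ (m j / d)) (Finset.mem_univ i)]
    have h1 : ∏ x ∈ Finset.univ.erase i, (X x ^ ((Finsupp.single i d + m) x % d) *
        f x ^ ((Finsupp.single i d + m) x / d)) =
        ∏ x ∈ Finset.univ.erase i, (X x ^ (m x % d) * f x ^ (m x / d)) := by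
      refine Finset.prod_congr rfl fun j hj => ?_
      have : j ≠ i := Finset.ne_of_mem_erase hj
      simp [this.symm]
    rw [h1]
    have h2 : (Finsupp.single i d + m) i = d + m i := by simp
    rw [h2, Nat.add_mod_left, Nat.add_div_left _ hd, pow_succ]
    ring
  exact LinearMap.congr_fun this p

end substPow

end MvPolynomial

namespace MvPolynomial

variable {n : ℕ}

/-- The map does not raise degrees, so it acts on the finite-dimensional space of degree at most e.
Its determinant there is a polynomial in δ, nonzero because it equals 1 at δ = 0. -/
theorem exists_polynomial_substPow_bijOn (d : ℕ) (g : Fin n → MvPolynomial (Fin n) ℝ)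
    (hg : ∀ i, (g i).totalDegree ≤ d) (e : ℕ) :
    ∃ D : Polynomial ℝ, D ≠ 0 ∧ ∀ δ : ℝ, D.eval δ ≠ 0 →
      (∀ p : MvPolynomial (Fin n) ℝ, p.totalDegree ≤ e →
        substPow d (fun i => X i ^ d + C δ * g i) p = 0 → p = 0) ∧
      ∀ q : MvPolynomial (Fin n) ℝ, q.totalDegree ≤ e →
        ∃ p, substPow d (fun i => X i ^ d + C δ * g i) p = q := by
  classical
  have hfin : Finite {m : Fin n →₀ ℕ // m.degree ≤ e} := by
    refine Set.Finite.to_subtype (s := {m : Fin n →₀ ℕ | m.degree ≤ e}) ?_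
    exact Finsupp.finite_of_degree_le e
  have : Fintype {m : Fin n →₀ ℕ // m.degree ≤ e} := Fintype.ofFinite _
  -- The system with δ kept as the indeterminate of ℝ[δ]; evaluation at a real δ recovers the actual
  -- one.
  let F : Fin n → MvPolynomial (Fin n) (Polynomial ℝ) :=
    fun i => X i ^ d + C Polynomial.X * map Polynomial.C (g i)
  let M : Matrix {m : Fin n →₀ ℕ // m.degree ≤ e} {m : Fin n →₀ ℕ // m.degree ≤ e}
    (Polynomial ℝ) := fun m m' => coeff m.1 (substPow d F (monomial m'.1 1))
  have hF (δ : ℝ) : (fun i => map (Polynomial.evalRingHom δ) (F i)) =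
      fun i => X i ^ d + C δ * g i := by
    funext i
    have : (Polynomial.evalRingHom δ).comp Polynomial.C = RingHom.id ℝ := by ext; simp
    simp [F, map_map, this, map_id]
  have hM (δ : ℝ) (m m' : {m : Fin n →₀ ℕ // m.degree ≤ e}) :
      (M.map (Polynomial.evalRingHom δ)) m m' =
        coeff m.1 (substPow d (fun i => X i ^ d + C δ * g i) (monomial m'.1 1)) := by
    rw [← hF, ← map_substPow_monomial, coeff_map]
    rfl
  have hdet (δ : ℝ) : M.det.eval δ = (M.map (Polynomial.evalRingHom δ)).det := by
    rw [← Polynomial.coe_evalRingHom, RingHom.map_det]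
    rfl
  have hlin (δ : ℝ) (c : {m : Fin n →₀ ℕ // m.degree ≤ e} → ℝ)
      (m : {m : Fin n →₀ ℕ // m.degree ≤ e}) :
      coeff m.1 (substPow d (fun i => X i ^ d + C δ * g i) (∑ m', c m' • monomial m'.1 1)) =
        (M.map (Polynomial.evalRingHom δ)).mulVec c m := by
    rw [map_sum, coeff_sum, Matrix.mulVec, dotProduct]
    refine Finset.sum_congr rfl fun m' _ => ?_
    rw [map_smul, coeff_smul, hM, smul_eq_mul, mul_comm]
  have hdeg (δ : ℝ) (i : Fin n) : (X i ^ d + C δ * g i).totalDegree ≤ d := by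
    refine (totalDegree_add _ _).trans (max_le (totalDegree_X_pow _ _).le ?_)
    refine (totalDegree_mul _ _).trans ?_
    simpa using hg i
  refine ⟨M.det, ?_, fun δ hδ => ?_⟩
  · intro h0
    have h1 := hdet 0
    rw [h0] at h1
    have : M.map (Polynomial.evalRingHom (0 : ℝ)) = 1 := by
      ext m m'
      rw [hM]
      simp only [map_zero, zero_mul, add_zero]
      rw [substPow_X_pow, coeff_monomial, Matrix.one_apply]
      simp [Subtype.ext_iff, eq_comm]
    rw [this] at h1
    simp at h1
  · rw [hdet] at hδ
    have hunit : IsUnit (M.map (Polynomial.evalRingHom δ)) :=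
      (Matrix.isUnit_iff_isUnit_det _).2 hδ.isUnit
    have hexp (p : MvPolynomial (Fin n) ℝ) (hp : p.totalDegree ≤ e) :
        p = ∑ m' : {m : Fin n →₀ ℕ // m.degree ≤ e}, coeff m'.1 p • monomial m'.1 1 := by
      ext m
      rw [coeff_sum]
      simp only [coeff_smul, coeff_monomial, smul_eq_mul, mul_ite, mul_one, mul_zero]
      by_cases hm : m.degree ≤ e
      · rw [Finset.sum_eq_single ⟨m, hm⟩]
        · simp
        · intro b _ hb
          rw [if_neg]
          exact fun h => hb (Subtype.ext h)
        · simp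
      · rw [Finset.sum_eq_zero]
        · by_contra hne
          exact hm ((le_totalDegree (mem_support_iff.2 hne)).trans hp)
        · intro b _
          rw [if_neg]
          rintro rfl
          exact hm b.2
    constructor
    · intro p hp h0
      have hc : (M.map (Polynomial.evalRingHom δ)).mulVec (fun m' => coeff m'.1 p) = 0 := by
        funext m
        rw [← hlin, ← hexp p hp, h0]
        simp
      have hc0 : (fun m' : {m : Fin n →₀ ℕ // m.degree ≤ e} => coeff m'.1 p) = 0 := by
        apply Matrix.mulVec_injective_of_isUnit hunit
        simpa using hc
      rw [hexp p hp]
      refine Finset.sum_eq_zero fun m _ => ?_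
      rw [congrFun hc0 m]
      simp
    · intro q hq
      obtain ⟨c, hc⟩ := (Matrix.mulVec_surjective_iff_isUnit.2 hunit) (fun m => coeff m.1 q)
      refine ⟨∑ m', c m' • monomial m'.1 1, ?_⟩
      ext m
      by_cases hm : m.degree ≤ e
      · exact (hlin δ c ⟨m, hm⟩).trans (congrFun hc ⟨m, hm⟩)
      · have h1 : coeff m q = 0 := by
          by_contra hne
          exact hm ((le_totalDegree (mem_support_iff.2 hne)).trans hq)
        rw [h1, map_sum, coeff_sum]
        refine Finset.sum_eq_zero fun m' _ => ?_
        rw [map_smul, coeff_smul]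
        by_contra hne
        refine hm ((le_totalDegree (mem_support_iff.2 (right_ne_zero_of_smul hne))).trans ?_)
        exact (totalDegree_substPow_monomial_le d _ (hdeg δ) _).trans m'.2

theorem exists_countable_substPow_bijective (d : ℕ) (g : Fin n → MvPolynomial (Fin n) ℝ)
    (hg : ∀ i, (g i).totalDegree ≤ d) :
    ∃ Z : Set ℝ, Z.Countable ∧ ∀ δ ∉ Z,
      Function.Bijective (substPow d (fun i => X i ^ d + C δ * g i)) := by
  choose D hD hbij using exists_polynomial_substPow_bijOn d g hg
  refine ⟨⋃ e, {δ | (D e).IsRoot δ}, ?_, fun δ hδ => ?_⟩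
  · exact Set.countable_iUnion fun e => (Polynomial.finite_setOfPred_isRoot (hD e)).countable
  · have hδ' (e : ℕ) : (D e).eval δ ≠ 0 := fun h => hδ (Set.mem_iUnion.2 ⟨e, h⟩)
    refine ⟨(injective_iff_map_eq_zero _).2 fun p hp => ?_, fun q => ?_⟩
    · exact (hbij _ δ (hδ' _)).1 p le_rfl hp
    · exact (hbij _ δ (hδ' _)).2 q le_rfl

/-- Bijectivity says that the products of X^a, all exponents below d, with powers of the f i form a
basis of the polynomial ring. Modulo the f i only the dⁿ monomials X^a survive. -/
theorem finrank_quotient_span_of_substPow_bijective {d : ℕ} (hd : 0 < d)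
    (f : Fin n → MvPolynomial (Fin n) ℝ) (hf : Function.Bijective (substPow d f)) :
    ∃ φ : MvPolynomial (Fin n) ℝ →ₗ[ℝ] ((Fin n → Fin d) → ℝ), Function.Surjective φ ∧
      LinearMap.ker φ = (Ideal.span (Set.range f)).restrictScalars ℝ := by
  classical
  let L := LinearEquiv.ofBijective (substPow d f) hf
  let ex : (Fin n → Fin d) → (Fin n →₀ ℕ) := fun a => Finsupp.equivFunOnFinite.symm fun i => a i
  have hex : Function.Injective ex := fun a b hab => by
    funext i
    have := DFunLike.congr_fun hab i
    exact Fin.ext this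
  let π : MvPolynomial (Fin n) ℝ →ₗ[ℝ] ((Fin n → Fin d) → ℝ) :=
    LinearMap.pi fun a => lcoeff ℝ (ex a)
  have hπ : Function.Surjective π := by
    intro v
    refine ⟨∑ a, v a • monomial (ex a) 1, ?_⟩
    funext b
    simp only [π, LinearMap.pi_apply, lcoeff_apply, coeff_sum, coeff_smul, coeff_monomial,
      hex.eq_iff, smul_eq_mul, mul_ite, mul_one, mul_zero]
    simp
  have hker : LinearMap.ker π =
      (Ideal.span (Set.range fun i : Fin n => (X i ^ d : MvPolynomial (Fin n) ℝ))).restrictScalars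
        ℝ := by
    ext p
    have hset : (Set.range fun i : Fin n => (X i ^ d : MvPolynomial (Fin n) ℝ)) =
        (fun s => monomial s 1) '' Set.range fun i : Fin n => Finsupp.single i d := by
      rw [← Set.range_comp]
      congr 1
      funext i
      simp [X_pow_eq_monomial]
    rw [hset, Submodule.restrictScalars_mem, mem_ideal_span_monomial_image]
    constructor
    · intro hp m hm
      by_contra! hcon
      have hlt (i : Fin n) : m i < d := by
        by_contra! hle
        exact hcon _ ⟨i, rfl⟩ (Finsupp.single_le_iff.2 hle)
      have := congrFun (LinearMap.mem_ker.1 hp) fun i => ⟨m i, hlt i⟩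
      have hm' : ex (fun i => ⟨m i, hlt i⟩) = m := by
        ext i
        rfl
      refine mem_support_iff.1 hm ?_
      rw [← hm']
      exact this
    · intro hp
      rw [LinearMap.mem_ker]
      funext a
      change coeff (ex a) p = 0
      by_contra hne
      obtain ⟨_, ⟨i, rfl⟩, hi⟩ := hp _ (mem_support_iff.2 hne)
      exact absurd (Finsupp.single_le_iff.1 hi) (not_le.2 (a i).2)
  refine ⟨π ∘ₗ L.symm.toLinearMap, hπ.comp L.symm.surjective, ?_⟩
  ext q
  obtain ⟨p, rfl⟩ := L.surjective q
  have h1 : L p ∈ LinearMap.ker (π ∘ₗ L.symm.toLinearMap) ↔ p ∈ LinearMap.ker π := by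
    simp [LinearMap.mem_ker]
  rw [h1, hker, Submodule.restrictScalars_mem, Submodule.restrictScalars_mem,
    Ideal.mem_span_range_iff_exists_fun, Ideal.mem_span_range_iff_exists_fun]
  have hsum (c : Fin n → MvPolynomial (Fin n) ℝ) :
      L (∑ i, c i * X i ^ d) = ∑ i, L (c i) * f i := by
    rw [map_sum]
    refine Finset.sum_congr rfl fun i _ => ?_
    rw [mul_comm, mul_comm _ (f i)]
    exact substPow_X_pow_mul d f hd i (c i)
  constructor
  · rintro ⟨c, rfl⟩
    exact ⟨fun i => L (c i), (hsum c).symm⟩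
  · rintro ⟨c, hc⟩
    refine ⟨fun i => L.symm (c i), L.injective ?_⟩
    rw [hsum, ← hc]
    simp

/-- A generic perturbation by `d`-th powers, `d` odd, of `n` real polynomials of degree at most
`d` in `n` variables has a common real zero. -/
theorem exists_countable_common_zero {d : ℕ} (hd : Odd d) (g : Fin n → MvPolynomial (Fin n) ℝ)
    (hg : ∀ i, (g i).totalDegree ≤ d) :
    ∃ Z : Set ℝ, Z.Countable ∧ ∀ δ ∉ Z, ∃ x : Fin n → ℝ, ∀ i, x i ^ d + δ * eval x (g i) = 0 := by
  obtain ⟨Z, hZ, hbij⟩ := exists_countable_substPow_bijective d g hg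
  refine ⟨Z, hZ, fun δ hδ => ?_⟩
  obtain ⟨φ, hφ, hker⟩ := finrank_quotient_span_of_substPow_bijective hd.pos _ (hbij δ hδ)
  set f : Fin n → MvPolynomial (Fin n) ℝ := fun i => X i ^ d + C δ * g i with hf
  let J := Ideal.span (Set.range f)
  let eq1 : (MvPolynomial (Fin n) ℝ ⧸ J) ≃ₗ[ℝ] ((Fin n → Fin d) → ℝ) :=
    (Submodule.Quotient.restrictScalarsEquiv ℝ J).symm ≪≫ₗ
      (Submodule.quotEquivOfEq _ _ hker.symm) ≪≫ₗ φ.quotKerEquivOfSurjective hφ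
  have : Module.Finite ℝ (MvPolynomial (Fin n) ℝ ⧸ J) := Module.Finite.equiv eq1.symm
  obtain ⟨χ⟩ := exists_algHom_real_of_odd_finrank (MvPolynomial (Fin n) ℝ ⧸ J) (by
    rw [eq1.finrank_eq, Module.finrank_fintype_fun_eq_card]
    simpa using hd.pow)
  let ev := χ.comp (Ideal.Quotient.mkₐ ℝ J)
  refine ⟨fun i => ev (X i), fun i => ?_⟩
  have h0 : ev (f i) = 0 := by
    have : Ideal.Quotient.mkₐ ℝ J (f i) = 0 :=
      Ideal.Quotient.eq_zero_iff_mem.2 (Ideal.subset_span ⟨i, rfl⟩)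
    rw [AlgHom.comp_apply, this, map_zero]
  have hev : ev = aeval fun i => ev (X i) := by
    ext i
    simp
  have hev' (p : MvPolynomial (Fin n) ℝ) : ev p = eval (fun i => ev (X i)) p := by
    conv_lhs => rw [hev]
    rw [← coe_aeval_eq_eval]
    rfl
  rw [hev'] at h0
  simpa [hf] using h0

end MvPolynomial

/-! ### Polynomial approximation, dehomogenization and Borsuk–Ulam -/

theorem exists_mvPolynomial_near_on_sphere {n : ℕ} (φ : EuclideanSpace ℝ (Fin n) → ℝ)
    (hφ : ContinuousOn φ (Metric.sphere 0 1)) {η : ℝ} (hη : 0 < η) :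
    ∃ q : MvPolynomial (Fin n) ℝ, ∀ x ∈ Metric.sphere (0 : EuclideanSpace ℝ (Fin n)) 1,
      |MvPolynomial.eval x q - φ x| < η := by
  let S := Metric.sphere (0 : EuclideanSpace ℝ (Fin n)) 1
  let coord : Fin n → C(S, ℝ) := fun i => ⟨fun x => (x : EuclideanSpace ℝ (Fin n)) i, by fun_prop⟩
  let ev : MvPolynomial (Fin n) ℝ →ₐ[ℝ] C(S, ℝ) := MvPolynomial.aeval coord
  have hev (q : MvPolynomial (Fin n) ℝ) (x : S) : ev q x = MvPolynomial.eval (x : _) q := by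
    have : (ContinuousMap.evalAlgHom ℝ ℝ x).comp ev =
        MvPolynomial.aeval (fun i => (x : EuclideanSpace ℝ (Fin n)) i) := by
      ext i
      simp only [ev, coord, AlgHom.comp_apply, MvPolynomial.aeval_X]
      rfl
    have h := DFunLike.congr_fun this q
    rw [MvPolynomial.aeval_eq_eval] at h
    exact h
  have hsep : ev.range.SeparatesPoints := by
    intro x y hxy
    have : ∃ i, (x : EuclideanSpace ℝ (Fin n)) i ≠ (y : EuclideanSpace ℝ (Fin n)) i := by
      by_contra! h
      exact hxy (Subtype.ext (PiLp.ext h))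
    obtain ⟨i, hi⟩ := this
    refine ⟨ev (MvPolynomial.X i), ⟨_, ⟨MvPolynomial.X i, rfl⟩, rfl⟩, ?_⟩
    rw [hev, hev]
    simpa using hi
  obtain ⟨⟨_, ⟨q, rfl⟩⟩, hq⟩ :=
    ContinuousMap.exists_mem_subalgebra_near_continuous_of_separatesPoints ev.range hsep
      (fun x : S => φ x) (continuousOn_iff_continuous_domRestrict.1 hφ) η hη
  refine ⟨q, fun x hx => ?_⟩
  have := hq ⟨x, hx⟩
  rw [Real.norm_eq_abs] at this
  have h2 := hev q ⟨x, hx⟩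
  simp only at h2
  rw [← h2]
  exact this

namespace MvPolynomial

/-- Even-degree monomials drop out of the odd part. For odd degree, d minus the degree is an even
number 2k, so the missing factor N^(2k) is the polynomial (1 + ∑ xᵢ²)^k. -/
theorem exists_dehomogenization_monomial {n d : ℕ} (hd : Odd d) (m : Fin (n + 1) →₀ ℕ)
    (hm : m.degree ≤ d) :
    ∃ g : MvPolynomial (Fin n) ℝ, g.totalDegree ≤ d ∧ ∀ (x : Fin n → ℝ) (N : ℝ), N ≠ 0 →
      N ^ 2 = 1 + ∑ i, x i ^ 2 → ∀ p : Fin (n + 1) → ℝ, (∀ i, N * p i = (Fin.cons 1 x : _ → ℝ) i) →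
      eval x g = N ^ d * ((eval p (monomial m (1 : ℝ)) - eval (-p) (monomial m 1)) / 2) := by
  have hneg (p : Fin (n + 1) → ℝ) :
      eval (-p) (monomial m (1 : ℝ)) = (-1) ^ m.degree * eval p (monomial m 1) := by
    rw [monomial_one_eq_prod, map_prod, map_prod, Finsupp.degree_eq_sum, ← Finset.prod_pow_eq_pow_sum,
      ← Finset.prod_mul_distrib]
    refine Finset.prod_congr rfl fun i _ => ?_
    simp [← mul_pow]
  rcases Nat.even_or_odd m.degree with he | ho
  · refine ⟨0, by simp, fun x N _ _ p _ => ?_⟩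
    rw [hneg, he.neg_one_pow]
    simp
  · obtain ⟨k, hk⟩ : ∃ k, d = m.degree + 2 * k := by
      obtain ⟨a, ha⟩ := hd
      obtain ⟨b, hb⟩ := ho
      exact ⟨a - b, by omega⟩
    refine ⟨(∏ j : Fin n, X j ^ m j.succ) * (1 + ∑ j : Fin n, X j ^ 2) ^ k, ?_, ?_⟩
    · refine (totalDegree_mul _ _).trans ?_
      rw [hk]
      refine Nat.add_le_add ?_ ?_
      · refine (totalDegree_finsetProd _ _).trans ?_
        rw [Finsupp.degree_eq_sum, Fin.sum_univ_succ]
        refine le_add_left (Finset.sum_le_sum fun j _ => ?_)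
        rw [totalDegree_X_pow]
      · refine (totalDegree_pow _ _).trans ?_
        rw [mul_comm 2]
        refine Nat.mul_le_mul_left _ ((totalDegree_add _ _).trans (max_le (by simp) ?_))
        refine (totalDegree_finsetSum _ _).trans (Finset.sup_le fun j _ => ?_)
        rw [totalDegree_X_pow]
    · intro x N hN0 hN p hp
      rw [hneg, ho.neg_one_pow, hk, pow_add, pow_mul, hN, monomial_one_eq_prod, map_prod]
      have h1 : N ^ m.degree * ∏ i, eval p (X i ^ m i : MvPolynomial (Fin (n + 1)) ℝ) =
          ∏ j : Fin n, x j ^ m j.succ := by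
        rw [Finsupp.degree_eq_sum, ← Finset.prod_pow_eq_pow_sum, ← Finset.prod_mul_distrib,
          Fin.prod_univ_succ]
        simp only [map_pow, eval_X, ← mul_pow, hp]
        simp
      simp only [map_mul, map_prod, map_pow, eval_X, map_add, map_one, map_sum] at h1 ⊢
      rw [← h1]
      ring

theorem exists_dehomogenization {n d : ℕ} (hd : Odd d) (q : MvPolynomial (Fin (n + 1)) ℝ)
    (hq : q.totalDegree ≤ d) :
    ∃ g : MvPolynomial (Fin n) ℝ, g.totalDegree ≤ d ∧ ∀ (x : Fin n → ℝ) (N : ℝ), N ≠ 0 →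
      N ^ 2 = 1 + ∑ i, x i ^ 2 → ∀ p : Fin (n + 1) → ℝ, (∀ i, N * p i = (Fin.cons 1 x : _ → ℝ) i) →
      eval x g = N ^ d * ((eval p q - eval (-p) q) / 2) := by
  have hm (m : q.support) : m.1.degree ≤ d := (le_totalDegree m.2).trans hq
  choose g hg1 hg2 using fun m : q.support => exists_dehomogenization_monomial (n := n) hd m.1 (hm m)
  refine ⟨∑ m, coeff m.1 q • g m, ?_, ?_⟩
  · refine (totalDegree_finsetSum _ _).trans (Finset.sup_le fun m _ => ?_)
    exact (totalDegree_smul_le _ _).trans (hg1 m)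
  · intro x N hN0 hN p hp
    have hexp : q = ∑ m : q.support, coeff m.1 q • monomial m.1 (1 : ℝ) := by
      conv_lhs => rw [q.as_sum]
      rw [← Finset.sum_coe_sort]
      refine Finset.sum_congr rfl fun m _ => ?_
      rw [smul_monomial, smul_eq_mul, mul_one]
    have hev (p : Fin (n + 1) → ℝ) :
        eval p q = ∑ m : q.support, coeff m.1 q * eval p (monomial m.1 (1 : ℝ)) := by
      conv_lhs => rw [hexp]
      rw [map_sum]
      simp only [smul_eval]
    rw [hev, hev, map_sum, ← Finset.sum_sub_distrib, Finset.sum_div, Finset.mul_sum]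
    refine Finset.sum_congr rfl fun m _ => ?_
    rw [smul_eval, hg2 m x N hN0 hN p hp]
    ring

end MvPolynomial

/-- The Borsuk–Ulam theorem: an odd continuous map from the unit sphere of `ℝⁿ⁺¹` to `ℝⁿ` has a
zero. -/
theorem borsukUlam {n : ℕ} (f : EuclideanSpace ℝ (Fin (n + 1)) → Fin n → ℝ)
    (hf : ContinuousOn f (Metric.sphere 0 1))
    (hodd : ∀ x ∈ Metric.sphere (0 : EuclideanSpace ℝ (Fin (n + 1))) 1, f (-x) = -f x) :
    ∃ x ∈ Metric.sphere (0 : EuclideanSpace ℝ (Fin (n + 1))) 1, f x = 0 := by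
  by_contra! hne
  obtain ⟨η, hη, hfη⟩ : ∃ η > 0, ∀ x ∈ Metric.sphere (0 : EuclideanSpace ℝ (Fin (n + 1))) 1,
      2 * η ≤ ‖f x‖ := by
    have hcomp := isCompact_sphere (0 : EuclideanSpace ℝ (Fin (n + 1))) 1
    have hnon : (Metric.sphere (0 : EuclideanSpace ℝ (Fin (n + 1))) 1).Nonempty :=
      NormedSpace.sphere_nonempty.2 zero_le_one
    obtain ⟨x₀, hx₀, hmin⟩ := hcomp.exists_isMinOn hnon hf.norm
    refine ⟨‖f x₀‖ / 2, half_pos (norm_pos_iff.2 (hne x₀ hx₀)), fun x hx => ?_⟩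
    rw [mul_div_cancel₀ _ two_ne_zero]
    exact hmin hx
  choose q hq using fun i : Fin n => exists_mvPolynomial_near_on_sphere (fun x => f x i)
    ((continuous_apply i).comp_continuousOn hf) hη
  let d := 2 * (∑ i, (q i).totalDegree) + 1
  have hd : Odd d := ⟨_, rfl⟩
  have hqd (i : Fin n) : (q i).totalDegree ≤ d := by
    have := Finset.single_le_sum (f := fun i => (q i).totalDegree) (fun _ _ => Nat.zero_le _)
      (Finset.mem_univ i)
    omega
  choose g hg1 hg2 using fun i => MvPolynomial.exists_dehomogenization hd (q i) (hqd i)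
  obtain ⟨Z, hZ, hzero⟩ := MvPolynomial.exists_countable_common_zero hd g hg1
  -- A countable set has dense complement, so δ can be both generic and larger than 1/η.
  obtain ⟨δ, hδZ, hδ⟩ := (hZ.dense_compl ℝ).exists_gt (1 / η)
  obtain ⟨x, hx⟩ := hzero δ hδZ
  have hδ0 : 0 < δ := (one_div_pos.2 hη).trans hδ
  have hpos : 0 < 1 + ∑ i, x i ^ 2 := by positivity
  set N := Real.sqrt (1 + ∑ i, x i ^ 2) with hN
  have hN0 : 0 < N := Real.sqrt_pos.2 hpos
  have hN2 : N ^ 2 = 1 + ∑ i, x i ^ 2 := Real.sq_sqrt hpos.le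
  let p : EuclideanSpace ℝ (Fin (n + 1)) := WithLp.toLp 2 fun i => (Fin.cons 1 x : _ → ℝ) i / N
  have hp (i : Fin (n + 1)) : N * p i = (Fin.cons 1 x : _ → ℝ) i := mul_div_cancel₀ _ hN0.ne'
  have hpS : p ∈ Metric.sphere (0 : EuclideanSpace ℝ (Fin (n + 1))) 1 := by
    rw [mem_sphere_zero_iff_norm, EuclideanSpace.norm_eq, Real.sqrt_eq_one]
    have : ∀ i, ‖p i‖ ^ 2 = (Fin.cons 1 x : Fin (n + 1) → ℝ) i ^ 2 / N ^ 2 := fun i => by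
      rw [Real.norm_eq_abs, sq_abs, ← div_pow]
    simp_rw [this]
    rw [← Finset.sum_div, Fin.sum_univ_succ, hN2]
    simpa using div_self hpos.ne'
  have hpS' : -p ∈ Metric.sphere (0 : EuclideanSpace ℝ (Fin (n + 1))) 1 := by simpa using hpS
  refine absurd (hfη p hpS) (not_le.2 ((pi_norm_lt_iff (by positivity)).2 fun i => ?_))
  have h1 := hx i
  have hneg : (-p).ofLp = -p.ofLp := rfl
  rw [hg2 i x N hN0.ne' hN2 p hp, ← hneg] at h1
  -- Q is the odd part of `q i` at p. The system reads p_{i+1}^d = −δQ with |p_{i+1}| ≤ 1, so |Q| ≤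
  -- 1/δ < η. As f is odd, Q is within η of f(p)ᵢ, hence |f(p)ᵢ| < 2η for every i.
  set Q := (MvPolynomial.eval p.ofLp (q i) - MvPolynomial.eval (-p).ofLp (q i)) / 2 with hQ
  have hxN : x i = N * p i.succ := by rw [hp]; simp
  have hp1 : |p i.succ| ≤ 1 := by
    have := PiLp.norm_apply_le p i.succ
    rwa [mem_sphere_zero_iff_norm.1 hpS] at this
  have hQ1 : |Q| < η := by
    have h2 : p i.succ ^ d = -(δ * Q) := by
      rw [hxN, mul_pow] at h1
      have : N ^ d * (p i.succ ^ d + δ * Q) = 0 := by linear_combination h1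
      have := (mul_eq_zero.1 this).resolve_left (pow_pos hN0 d).ne'
      linarith
    have h3 : δ * |Q| ≤ 1 := by
      rw [← abs_of_pos hδ0, ← abs_mul, ← abs_neg, ← h2, abs_pow]
      exact pow_le_one₀ (abs_nonneg _) hp1
    rw [div_lt_iff₀ hη] at hδ
    by_contra! hcon
    nlinarith
  have h4 := hq i p hpS
  have h5 := hq i (-p) hpS'
  rw [hodd p hpS, Pi.neg_apply] at h5
  rw [Real.norm_eq_abs]
  rw [abs_lt] at *
  constructor <;> linarith [h4.1, h4.2, h5.1, h5.2, hQ1.1, hQ1.2]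

/-! ### The genus families -/

noncomputable section

namespace EnergyCurves

variable {X : Type*} [NormedAddCommGroup X]

theorem mem_unitSphere {u : X} : u ∈ unitSphere X ↔ ‖u‖ = 1 := mem_sphere_zero_iff_norm

theorem ne_zero_of_mem_unitSphere {u : X} (hu : u ∈ unitSphere X) : u ≠ 0 := by
  rintro rfl
  simp [mem_unitSphere] at hu

theorem neg_mem_unitSphere {u : X} (hu : u ∈ unitSphere X) : -u ∈ unitSphere X := by
  simpa [mem_unitSphere] using hu

theorem le_genus_iff {F : Set X} {n : ℕ} :
    (n : ℕ∞) ≤ genus F ↔ ∀ (k : ℕ) (h : X → EuclideanSpace ℝ (Fin k)), ContinuousOn h F →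
      (∀ x ∈ F, h x ≠ 0) → (∀ x ∈ F, h (-x) = -h x) → n ≤ k := by
  rw [genus, le_sInf_iff]
  constructor
  · intro H k h h1 h2 h3
    exact_mod_cast H k ⟨k, rfl, h, h1, h2, h3⟩
  · rintro H _ ⟨k, rfl, h, h1, h2, h3⟩
    exact_mod_cast H k h h1 h2 h3

variable [NormedSpace ℝ X]

theorem continuousOn_normalize :
    ContinuousOn (fun u : X => ‖u‖⁻¹ • u) {0}ᶜ :=
  (continuousOn_id.norm.inv₀ fun _ hu => norm_ne_zero_iff.2 hu).smul continuousOn_id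

theorem normalize_mem_unitSphere {u : X} (hu : u ≠ 0) : ‖u‖⁻¹ • u ∈ unitSphere X := by
  rw [mem_unitSphere, norm_smul, norm_inv, norm_norm, inv_mul_cancel₀ (norm_ne_zero_iff.2 hu)]

/-- An injective linear map from ℝⁿ⁺¹, followed by radial projection, gives an odd image of the
n-sphere. An odd nonvanishing map from it to ℝᵏ with k < n, padded by zeros to ℝⁿ, would contradict
Borsuk–Ulam. -/
theorem genusFamily_nonempty (hdim : ¬ FiniteDimensional ℝ X) (n : ℕ) :
    (genusFamily X n).Nonempty := by
  have hrank : ((n + 1 : ℕ) : Cardinal) ≤ Module.rank ℝ X := by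
    rw [FiniteDimensional, ← Module.rank_lt_aleph0_iff, not_lt] at hdim
    exact (Cardinal.natCast_lt_aleph0).le.trans hdim
  obtain ⟨b, hb⟩ := exists_linearIndependent_of_le_rank hrank
  let e : EuclideanSpace ℝ (Fin (n + 1)) →ₗ[ℝ] X :=
    (Fintype.linearCombination ℝ b) ∘ₗ (WithLp.linearEquiv 2 ℝ (Fin (n + 1) → ℝ)).toLinearMap
  have he : Function.Injective e :=
    (linearIndependent_iff_injective_fintypeLinearCombination.1 hb).comp
      (WithLp.linearEquiv 2 ℝ (Fin (n + 1) → ℝ)).injective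
  have hec : Continuous e := e.continuous_of_finiteDimensional
  let S := Metric.sphere (0 : EuclideanSpace ℝ (Fin (n + 1))) 1
  have hne (v) (hv : v ∈ S) : e v ≠ 0 := by
    rw [Ne, map_eq_zero_iff e he]
    rintro rfl
    simp [S] at hv
  let g : EuclideanSpace ℝ (Fin (n + 1)) → X := fun v => ‖e v‖⁻¹ • e v
  have hg : ContinuousOn g S := continuousOn_normalize.comp hec.continuousOn hne
  have hgneg (v) : g (-v) = -g v := by simp [g]
  refine ⟨g '' S, ?_, ?_, ?_, ?_, ?_⟩
  · rintro _ ⟨v, hv, rfl⟩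
    exact normalize_mem_unitSphere (hne v hv)
  · exact (NormedSpace.sphere_nonempty.2 zero_le_one).image g
  · exact (isCompact_sphere _ _).image_of_continuousOn hg
  · rintro _ ⟨v, hv, rfl⟩
    exact ⟨-v, by simpa [S] using hv, hgneg v⟩
  · rw [le_genus_iff]
    intro k h h1 h2 h3
    by_contra! hk
    obtain ⟨v, hv, h0⟩ := borsukUlam
      (fun v i => if hi : (i : ℕ) < k then h (g v) ⟨i, hi⟩ else 0) (by
        refine continuousOn_pi.2 fun i => ?_
        by_cases hi : (i : ℕ) < k
        · simp only [hi, dite_true]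
          exact (EuclideanSpace.proj (𝕜 := ℝ) (⟨i, hi⟩ : Fin k)).continuous.comp_continuousOn
            (h1.comp hg (mapsTo_image g S))
        · simp only [hi, dite_false]
          exact continuousOn_const) (by
        intro v hv
        funext i
        by_cases hi : (i : ℕ) < k
        · simp [hi, hgneg, h3 _ (mem_image_of_mem g hv)]
        · simp [hi])
    refine h2 _ (mem_image_of_mem g hv) (PiLp.ext fun i => ?_)
    have := congrFun h0 ⟨i, i.2.trans hk⟩
    simpa using this

/-- An odd map on the image composes with g to one on F, so genus does not drop. Since g lives on
the subtype, oddness is phrased for pairs of opposite points. -/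
theorem range_mem_genusFamily {n : ℕ} {F : Set X} (hF : F ∈ genusFamily X n) (g : F → X)
    (hg : Continuous g) (hgS : ∀ u, g u ∈ unitSphere X)
    (hodd : ∀ u v : F, (v : X) = -u → g v = -g u) : range g ∈ genusFamily X n := by
  obtain ⟨-, hne, hcomp, hsymm, hgen⟩ := hF
  have : CompactSpace F := isCompact_iff_compactSpace.1 hcomp
  have : Nonempty F := hne.to_subtype
  refine ⟨range_subset_iff.2 hgS, range_nonempty g, isCompact_range hg, ?_, ?_⟩
  · rintro _ ⟨u, rfl⟩
    exact ⟨⟨-u, hsymm u u.2⟩, hodd u _ rfl⟩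
  · rw [le_genus_iff] at hgen ⊢
    intro k h h1 h2 h3
    classical
    refine hgen k (fun u => if hu : u ∈ F then h (g ⟨u, hu⟩) else 0) ?_ ?_ ?_
    · rw [continuousOn_iff_continuous_domRestrict]
      have : F.domRestrict (fun u => if hu : u ∈ F then h (g ⟨u, hu⟩) else 0) = h ∘ g := by
        funext u
        simp
      rw [this]
      exact h1.comp_continuous hg mem_range_self
    · intro u hu
      simpa [hu] using h2 _ (mem_range_self _)
    · intro u hu
      simp [hu, hsymm u hu, hodd ⟨u, hu⟩ ⟨-u, hsymm u hu⟩ rfl, h3 _ (mem_range_self _)]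

end EnergyCurves

end

/-! ### Discrete descent -/

/-- Iterates of a continuous descent map reach the target set after finitely many steps, uniformly
on compact sets. -/
theorem exists_iterate_mem_of_descent {D : Type*} [MetricSpace D] [CompleteSpace D] {Φ : D → D}
    (hΦ : Continuous Φ) {ψ τ : D → ℝ} (hτ : Continuous τ) (hτ0 : ∀ p, 0 ≤ τ p) {κ m : ℝ}
    (hκ : 0 < κ) (hm : ∀ p, m ≤ ψ p) (hdist : ∀ p, dist p (Φ p) ≤ 2 * τ p)
    (hdesc : ∀ p, ψ (Φ p) ≤ ψ p - κ * τ p) {T W : Set D} (hW : IsOpen W) (hTW : T ⊆ W)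
    (hWT : ∀ p ∈ W, Φ p ∈ T) (hT : ∀ p, τ p = 0 → p ∈ T) {F : Set D} (hF : IsCompact F) :
    ∃ N : ℕ, ∀ p ∈ F, Φ^[N] p ∈ T := by
  -- The descent bounds the sum of τ along the orbit by (ψ(p) − m)/κ. The orbit is therefore Cauchy
  -- and its limit has τ = 0, so it lies in T and the orbit enters the open set W.
  have hpt (p : D) : ∃ k : ℕ, Φ^[k] p ∈ W := by
    have hsum (k : ℕ) : κ * ∑ i ∈ Finset.range k, τ (Φ^[i] p) ≤ ψ p - ψ (Φ^[k] p) := by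
      induction k with
      | zero => simp
      | succ k ih =>
        rw [Finset.sum_range_succ, mul_add, Function.iterate_succ_apply']
        linarith [hdesc (Φ^[k] p)]
    have hs : Summable fun i => τ (Φ^[i] p) := by
      refine summable_of_sum_range_le (c := (ψ p - m) / κ) (fun i => hτ0 _) fun k => ?_
      rw [le_div_iff₀ hκ, mul_comm]
      linarith [hsum k, hm (Φ^[k] p)]
    have hcau : CauchySeq fun i => Φ^[i] p := by
      refine cauchySeq_of_dist_le_of_summable _ (fun i => ?_) (hs.mul_left 2)
      rw [Nat.succ_eq_add_one, Function.iterate_succ_apply']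
      exact hdist _
    obtain ⟨q, hq⟩ := cauchySeq_tendsto_of_complete hcau
    have h0 : τ q = 0 :=
      tendsto_nhds_unique ((hτ.tendsto q).comp hq) hs.tendsto_atTop_zero
    exact (hq.eventually (hW.mem_nhds (hTW (hT q h0)))).exists
  -- W is mapped into T ⊆ W, so the entrance sets increase with k and compactness yields one k for
  -- all of F.
  have hmono : Monotone fun k : ℕ => {p | Φ^[k] p ∈ W} := by
    refine monotone_nat_of_le_succ fun k p hp => ?_
    change Φ^[k + 1] p ∈ W
    rw [Function.iterate_succ_apply']
    exact hTW (hWT _ hp)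
  obtain ⟨N, hN⟩ := hF.elim_directed_cover (fun k : ℕ => {p | Φ^[k] p ∈ W})
    (fun k => hW.preimage (hΦ.iterate k)) (fun p _ => mem_iUnion.2 (hpt p)) hmono.directed_le
  refine ⟨N + 1, fun p hp => ?_⟩
  rw [Function.iterate_succ_apply']
  exact hWT _ (hN hp)

/-! ### Spherical families and an equivariant descent field -/

noncomputable section

namespace EnergyCurves

variable {X : Type*} [NormedAddCommGroup X] [NormedSpace ℝ X]

/-- A family of `C¹`, even, positively `0`-homogeneous functionals on `X \ {0}`, depending in a
`C¹` way on a parameter in the open set `I`. -/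
structure IsSphericalFamily (I : Set ℝ) (L : ℝ → X → ℝ) : Prop where
  isOpen : IsOpen I
  contDiffOn : ContDiffOn ℝ 1 (Function.uncurry L) (I ×ˢ ({0}ᶜ : Set X))
  even : ∀ c ∈ I, ∀ u : X, u ≠ 0 → L c (-u) = L c u
  homogeneous : ∀ c ∈ I, ∀ u : X, u ≠ 0 → ∀ s : ℝ, 0 < s → L c (s • u) = L c u

namespace IsSphericalFamily

variable {I : Set ℝ} {L : ℝ → X → ℝ} (hL : IsSphericalFamily I L)
include hL

theorem isOpen_prod : IsOpen (I ×ˢ ({0}ᶜ : Set X)) := hL.isOpen.prod isOpen_compl_singleton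

theorem prod_mem_nhds {c : ℝ} {u : X} (hc : c ∈ I) (hu : u ≠ 0) :
    I ×ˢ ({0}ᶜ : Set X) ∈ 𝓝 (c, u) :=
  hL.isOpen_prod.mem_nhds (mk_mem_prod hc hu)

theorem hasStrictFDerivAt {c : ℝ} {u : X} (hc : c ∈ I) (hu : u ≠ 0) :
    HasStrictFDerivAt (Function.uncurry L) (fderiv ℝ (Function.uncurry L) (c, u)) (c, u) :=
  (hL.contDiffOn.contDiffAt (hL.prod_mem_nhds hc hu)).hasStrictFDerivAt one_ne_zero

theorem continuousAt_fderiv {c : ℝ} {u : X} (hc : c ∈ I) (hu : u ≠ 0) :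
    ContinuousAt (fderiv ℝ (Function.uncurry L)) (c, u) :=
  (hL.contDiffOn.continuousOn_fderiv_of_isOpen hL.isOpen_prod le_rfl).continuousAt
    (hL.prod_mem_nhds hc hu)

theorem continuousAt {c : ℝ} {u : X} (hc : c ∈ I) (hu : u ≠ 0) :
    ContinuousAt (Function.uncurry L) (c, u) :=
  (hL.hasStrictFDerivAt hc hu).continuousAt

theorem hasDerivAt_left {c : ℝ} {u : X} (hc : c ∈ I) (hu : u ≠ 0) :
    HasDerivAt (fun s => L s u) (fderiv ℝ (Function.uncurry L) (c, u) (1, 0)) c := by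
  have h1 : HasDerivAt (fun s : ℝ => (s, u)) (1, 0) c :=
    (hasDerivAt_id c).prodMk (hasDerivAt_const c u)
  exact HasFDerivAt.comp_hasDerivAt (f := fun s : ℝ => (s, u)) c
    (hL.hasStrictFDerivAt hc hu).hasFDerivAt h1

theorem fderiv_right {c : ℝ} {u : X} (hc : c ∈ I) (hu : u ≠ 0) (w : X) :
    fderiv ℝ (L c) u w = fderiv ℝ (Function.uncurry L) (c, u) (0, w) := by
  have := ((hL.hasStrictFDerivAt hc hu).hasFDerivAt.comp u
    ((hasFDerivAt_const c u).prodMk (hasFDerivAt_id u))).fderiv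
  have h2 : fderiv ℝ (L c) u = _ := this
  rw [h2]
  simp

theorem fderiv_neg {c : ℝ} {u : X} (hc : c ∈ I) (hu : u ≠ 0) (r : ℝ) (w : X) :
    fderiv ℝ (Function.uncurry L) (c, -u) (r, w) =
      fderiv ℝ (Function.uncurry L) (c, u) (r, -w) := by
  have h1 : HasFDerivAt (fun p : ℝ × X => Function.uncurry L (p.1, -p.2))
      ((fderiv ℝ (Function.uncurry L) (c, u)).comp
        ((ContinuousLinearMap.fst ℝ ℝ X).prod (-ContinuousLinearMap.snd ℝ ℝ X))) (c, -u) := by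
    have h2 : HasFDerivAt (fun p : ℝ × X => (p.1, -p.2))
        ((ContinuousLinearMap.fst ℝ ℝ X).prod (-ContinuousLinearMap.snd ℝ ℝ X)) (c, -u) :=
      (hasFDerivAt_fst (𝕜 := ℝ) (E := ℝ) (F := X)).prodMk
        (hasFDerivAt_snd (𝕜 := ℝ) (E := ℝ) (F := X)).neg
    refine HasFDerivAt.comp (g := Function.uncurry L) (f := fun p : ℝ × X => (p.1, -p.2)) (c, -u) ?_ h2
    rw [neg_neg]
    exact (hL.hasStrictFDerivAt hc hu).hasFDerivAt
  have h3 : (fun p : ℝ × X => Function.uncurry L (p.1, -p.2)) =ᶠ[𝓝 (c, -u)]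
      Function.uncurry L := by
    filter_upwards [hL.prod_mem_nhds hc (neg_ne_zero.2 hu)] with p hp
    exact hL.even _ hp.1 _ hp.2
  rw [(h3.hasFDerivAt_iff.1 h1).fderiv]
  simp

/-- By (PSG), at bounded levels either the gradient on the sphere or the derivative with respect to
the parameter is under control, locally uniformly in the parameter. -/
theorem exists_bound_or_gradient (hPSG : PSG I L) {m : ℝ} {c₀ : ℝ} (hc₀ : c₀ ∈ I)
    (hm : ∀ᶠ c in 𝓝 c₀, ∀ u ∈ unitSphere X, m ≤ L c u) (C : ℝ) :
    ∃ M > 0, ∃ ε > 0, ∀ᶠ c in 𝓝 c₀, ∀ u ∈ unitSphere X, L c u ≤ C →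
      ε ≤ ‖sphereDeriv (L c) u‖ ∨
        |fderiv ℝ (Function.uncurry L) (c, u) (1, 0)| ≤ M := by
  by_contra! hcon
  have hex (k : ℕ) : ∃ c, dist c c₀ < 1 / (k + 1 : ℝ) ∧ c ∈ I ∧ (∀ u ∈ unitSphere X, m ≤ L c u) ∧
      ∃ u ∈ unitSphere X, L c u ≤ C ∧ ‖sphereDeriv (L c) u‖ < 1 / (k + 1 : ℝ) ∧
        (k + 1 : ℝ) < |fderiv ℝ (Function.uncurry L) (c, u) (1, 0)| := by
    have hk : (0 : ℝ) < 1 / (k + 1 : ℝ) := Nat.one_div_pos_of_nat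
    have e1 : ∀ᶠ c in 𝓝 c₀, c ∈ Metric.ball c₀ (1 / (k + 1 : ℝ)) := Metric.ball_mem_nhds c₀ hk
    have e2 : ∀ᶠ c in 𝓝 c₀, c ∈ I := hL.isOpen.mem_nhds hc₀
    obtain ⟨c, ⟨u, hu, h1, h2, h3⟩, hc1, hc2, hc3⟩ :=
      ((hcon (k + 1) (by positivity) _ hk).and_eventually (e1.and (e2.and hm))).exists
    exact ⟨c, hc1, hc2, hc3, u, hu, h1, h2, h3⟩
  choose cs hcs1 hcs2 hcs3 w hw hw1 hw2 hw3 using hex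
  have hlim : Tendsto (fun k : ℕ => 1 / (k + 1 : ℝ)) atTop (𝓝 0) :=
    tendsto_one_div_add_atTop_nhds_zero_nat
  have hcs : Tendsto cs atTop (𝓝 c₀) := by
    rw [tendsto_iff_dist_tendsto_zero]
    exact squeeze_zero (fun _ => dist_nonneg) (fun k => (hcs1 k).le) hlim
  -- The lower bound m and the level C make (PSG) applicable. At the limit u the derivative in c is
  -- continuous, which contradicts its blow-up along the sequence.
  obtain ⟨u, φ, hφ, hu⟩ := hPSG c₀ cs w hc₀ hcs2 hcs hw
    ⟨max |m| |C|, fun k => abs_le_max_abs_abs (hcs3 k _ (hw k)) (hw1 k)⟩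
    (squeeze_zero (fun k => norm_nonneg (sphereDeriv (L (cs k)) (w k))) (fun k => (hw2 k).le) hlim)
  have huS : u ∈ unitSphere X :=
    Metric.isClosed_sphere.mem_of_tendsto hu (Eventually.of_forall fun k => hw (φ k))
  have hcont : Tendsto (fun k => |fderiv ℝ (Function.uncurry L) (cs (φ k), w (φ k)) (1, 0)|) atTop
      (𝓝 |fderiv ℝ (Function.uncurry L) (c₀, u) (1, 0)|) := by
    have h1 := hL.continuousAt_fderiv hc₀ (ne_zero_of_mem_unitSphere huS)
    have h2 : Tendsto (fun k => (cs (φ k), w (φ k))) atTop (𝓝 (c₀, u)) :=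
      (hcs.comp hφ.tendsto_atTop).prodMk_nhds hu
    exact ((h1.clm_apply continuousAt_const).tendsto.comp h2).abs
  have hinf : Tendsto (fun k => |fderiv ℝ (Function.uncurry L) (cs (φ k), w (φ k)) (1, 0)|) atTop
      atTop := by
    refine tendsto_atTop_mono (fun k => (hw3 (φ k)).le) ?_
    exact tendsto_atTop_add_const_right _ _
      (tendsto_natCast_atTop_atTop.comp hφ.tendsto_atTop)
  exact not_tendsto_nhds_of_tendsto_atTop hinf _ hcont

/-- A continuous descent field for `L c u + K c`, strictly decreasing the parameter. -/
theorem exists_descent_field {D : Set (ℝ × X)} (hD : D ⊆ I ×ˢ unitSphere X)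
    (hsymm : ∀ p ∈ D, (p.1, -p.2) ∈ D) {M ε : ℝ} (hε : 0 < ε)
    (hdich : ∀ p ∈ D, ε ≤ ‖sphereDeriv (L p.1) p.2‖ ∨
        |fderiv ℝ (Function.uncurry L) p (1, 0)| ≤ M) :
    ∃ κ > 0, ∃ (ρ : C(D, ℝ)) (w : C(D, X)), (∀ p, 0 < ρ p) ∧ (∀ p, ρ p ≤ 1) ∧ (∀ p, ‖w p‖ ≤ 1) ∧
      (∀ p : D, κ < fderiv ℝ (Function.uncurry L) p (ρ p, w p) + (M + 1) * ρ p) ∧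
      ∀ p q : D, (q : ℝ × X) = (p.1.1, -p.1.2) → ρ q = ρ p ∧ w q = -w p := by
  -- Strictly below both available rates: 1 from moving c, and ε/2 from moving u.
  let κ := min 1 (ε / 2) / 2
  have hκ : 0 < κ := by positivity
  have hκ1 : κ < 1 := by
    have : min 1 (ε / 2) ≤ 1 := min_le_left _ _
    simp only [κ]
    linarith
  have hκ2 : κ < ε / 2 := by
    have : min 1 (ε / 2) ≤ ε / 2 := min_le_right _ _
    simp only [κ]
    linarith
  let A : D → ℝ × X → ℝ := fun p v => fderiv ℝ (Function.uncurry L) p v + (M + 1) * v.1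
  -- Admissible directions form convex sets defined by conditions open in p, so locally constant
  -- choices can be glued to a continuous one.
  let t : D → Set (ℝ × X) := fun p => {v | (0 < v.1 ∧ v.1 ≤ 1) ∧ ‖v.2‖ ≤ 1 ∧ κ < A p v}
  have hAlin (p : D) (a b : ℝ) (v v' : ℝ × X) : A p (a • v + b • v') = a * A p v + b * A p v' := by
    simp only [A, map_add, map_smul, smul_eq_mul, Prod.fst_add, Prod.smul_fst]
    ring
  have hconv (p : D) : Convex ℝ (t p) := by
    rintro v ⟨⟨h1, h2⟩, h3, h4⟩ v' ⟨⟨h1', h2'⟩, h3', h4'⟩ a b ha hb hab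
    refine ⟨convex_Ioc (0 : ℝ) 1 ⟨h1, h2⟩ ⟨h1', h2'⟩ ha hb hab, ?_, ?_⟩
    · have := convex_closedBall (0 : X) 1 (mem_closedBall_zero_iff.2 h3)
        (mem_closedBall_zero_iff.2 h3') ha hb hab
      exact mem_closedBall_zero_iff.1 this
    · change κ < A p (a • v + b • v')
      rw [hAlin]
      exact convex_Ioi κ h4 h4' ha hb hab
  have hAcont (p : D) (v : ℝ × X) : ContinuousAt (fun q => A q v) p := by
    have h1 : ContinuousAt (fun q : D => fderiv ℝ (Function.uncurry L) q) p :=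
      ContinuousAt.comp (f := fun q : D => (q : ℝ × X))
        (hL.continuousAt_fderiv (hD p.2).1 (ne_zero_of_mem_unitSphere (hD p.2).2))
        continuous_subtype_val.continuousAt
    exact (h1.clm_apply continuousAt_const).add continuousAt_const
  have hloc (p : D) : ∃ v : ℝ × X, ∀ᶠ q in 𝓝 p, v ∈ t q := by
    suffices ∃ v, v ∈ t p by
      obtain ⟨v, h1, h2, h3⟩ := this
      refine ⟨v, ?_⟩
      filter_upwards [(hAcont p v).eventually (lt_mem_nhds h3)] with q hq
      exact ⟨h1, h2, hq⟩
    rcases hdich p p.2 with h | h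
    · obtain ⟨x, hx1, hx2⟩ :=
        ContinuousLinearMap.exists_lt_apply_of_lt_opNorm (sphereDeriv (L p.1.1) p.1.2)
          (lt_of_lt_of_le (half_lt_self hε) h)
      obtain ⟨w, hw1, hw2⟩ : ∃ w : X, ‖w‖ ≤ 1 ∧
          ε / 2 < fderiv ℝ (Function.uncurry L) p (0, w) := by
        have h5 (y : tangentSphere p.1.2) : sphereDeriv (L p.1.1) p.1.2 y =
            fderiv ℝ (Function.uncurry L) p (0, (y : X)) :=
          hL.fderiv_right (hD p.2).1 (ne_zero_of_mem_unitSphere (hD p.2).2) (y : X)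
        rw [Real.norm_eq_abs, lt_abs] at hx2
        rcases hx2 with h6 | h6
        · exact ⟨x, hx1.le, by rwa [← h5]⟩
        · refine ⟨((-x : tangentSphere p.1.2) : X), by simpa using hx1.le, ?_⟩
          rw [← h5, map_neg]
          exact h6
      -- Pure motion in u already gives the rate, but the parameter component must be positive; a
      -- small r > 0 is added by continuity.
      have hcont : Tendsto (fun r : ℝ => A p (r, w)) (𝓝[>] 0) (𝓝 (A p (0, w))) := by
        have : Continuous fun r : ℝ => A p (r, w) := by
          simp only [A]
          fun_prop
        exact this.continuousAt.tendsto.mono_left nhdsWithin_le_nhds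
      have h7 : κ < A p (0, w) := by
        simp only [A, mul_zero, add_zero]
        exact hκ2.trans hw2
      obtain ⟨r, hr, hr2⟩ := ((hcont.eventually (lt_mem_nhds h7)).and
        (Ioc_mem_nhdsGT (zero_lt_one : (0 : ℝ) < 1))).exists
      exact ⟨(r, w), ⟨hr2.1, hr2.2⟩, hw1, hr⟩
    · refine ⟨(1, 0), ⟨one_pos, le_rfl⟩, by simp, ?_⟩
      have := (abs_le.1 h).1
      change κ < fderiv ℝ (Function.uncurry L) p (1, 0) + (M + 1) * 1
      linarith
  obtain ⟨V, hV⟩ := exists_continuous_forall_mem_convex_of_local_const hconv hloc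
  let σ : D → D := fun p => ⟨(p.1.1, -p.1.2), hsymm p p.2⟩
  have hσ : Continuous σ := by
    refine Continuous.subtype_mk ?_ _
    fun_prop
  have hσσ (p : D) : σ (σ p) = p := Subtype.ext (Prod.ext rfl (neg_neg _))
  have hV' (p : D) : ((V (σ p)).1, -(V (σ p)).2) ∈ t p := by
    obtain ⟨h1, h2, h3⟩ := hV (σ p)
    refine ⟨h1, by simpa using h2, ?_⟩
    have h4 := hL.fderiv_neg (hD p.2).1 (ne_zero_of_mem_unitSphere (hD p.2).2) (V (σ p)).1
      (V (σ p)).2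
    change κ < fderiv ℝ (Function.uncurry L) p ((V (σ p)).1, -(V (σ p)).2) + _
    rw [← show fderiv ℝ (Function.uncurry L) (σ p) (V (σ p)) = _ from h4]
    exact h3
  -- Averaging the selection with its reflection makes the field equivariant and, by convexity,
  -- keeps it admissible.
  have hmid (p : D) := hconv p (hV p) (hV' p) (a := 1 / 2) (b := 1 / 2) (by norm_num) (by norm_num)
    (by norm_num)
  refine ⟨κ, hκ, ⟨fun p => (1 / 2 : ℝ) • (V p).1 + (1 / 2 : ℝ) • (V (σ p)).1, ?_⟩,
    ⟨fun p => (1 / 2 : ℝ) • (V p).2 + (1 / 2 : ℝ) • -(V (σ p)).2, ?_⟩,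
    fun p => (hmid p).1.1, fun p => (hmid p).1.2, fun p => (hmid p).2.1, fun p => (hmid p).2.2, ?_⟩
  · fun_prop
  · fun_prop
  · intro p q hq
    obtain rfl : q = σ p := Subtype.ext hq
    simp only [ContinuousMap.coe_mk, hσσ]
    constructor
    · exact add_comm _ _
    · rw [smul_neg, smul_neg, neg_add, neg_neg, add_comm]

end IsSphericalFamily

end EnergyCurves

end

/-! ### Transporting sets of the genus family to a smaller parameter -/

noncomputable section

namespace EnergyCurves

variable {X : Type*} [NormedAddCommGroup X] [NormedSpace ℝ X]

theorem norm_sub_normalize_le {u v : X} (hu : ‖u‖ = 1) (hv : v ≠ 0) :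
    ‖u - ‖v‖⁻¹ • v‖ ≤ 2 * ‖u - v‖ := by
  have hv' : ‖v‖ ≠ 0 := norm_ne_zero_iff.2 hv
  have h1 : ‖v - ‖v‖⁻¹ • v‖ ≤ ‖u - v‖ := by
    have h2 : v - ‖v‖⁻¹ • v = (1 - ‖v‖⁻¹) • v := by rw [sub_smul, one_smul]
    calc ‖v - ‖v‖⁻¹ • v‖ = |(1 - ‖v‖⁻¹) * ‖v‖| := by
          rw [h2, norm_smul, abs_mul, abs_norm, Real.norm_eq_abs]
      _ = |‖v‖ - ‖u‖| := by
          rw [sub_mul, one_mul, inv_mul_cancel₀ hv', hu]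
      _ ≤ ‖u - v‖ := by
          rw [norm_sub_rev]
          exact abs_norm_sub_norm_le v u
  calc ‖u - ‖v‖⁻¹ • v‖ = ‖(u - v) + (v - ‖v‖⁻¹ • v)‖ := by rw [sub_add_sub_cancel]
    _ ≤ ‖u - v‖ + ‖v - ‖v‖⁻¹ • v‖ := norm_add_le _ _
    _ ≤ 2 * ‖u - v‖ := by linarith

namespace IsSphericalFamily

variable {I : Set ℝ} {L : ℝ → X → ℝ}

/-- A continuous step size along which a descent field decreases `L c u + K c`. -/
theorem exists_step_size (hL : IsSphericalFamily I L) {D : Set (ℝ × X)}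
    (hD : D ⊆ I ×ˢ unitSphere X) (hsymm : ∀ p ∈ D, (p.1, -p.2) ∈ D) {K κ : ℝ}
    (ρ : C(D, ℝ)) (w : C(D, X)) (hρ0 : ∀ p, 0 < ρ p) (hρ1 : ∀ p, ρ p ≤ 1) (hw : ∀ p, ‖w p‖ ≤ 1)
    (hκ : ∀ p : D, κ < fderiv ℝ (Function.uncurry L) p (ρ p, w p) + K * ρ p) :
    ∃ h : C(D, ℝ), (∀ p, 0 < h p) ∧ (∀ p, h p ≤ 1 / 2) ∧
      (∀ p q : D, ∀ s, 0 ≤ s → s ≤ h p → (q = p ∨ (q : ℝ × X) = (p.1.1, -p.1.2)) →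
        L (q.1.1 - s * ρ q) (q.1.2 - s • w q) + K * (q.1.1 - s * ρ q) ≤
          L q.1.1 q.1.2 + K * q.1.1 - κ * s) ∧
      ∀ p q : D, (q : ℝ × X) = (p.1.1, -p.1.2) → h q = h p := by
  let P : D → ℝ → Prop := fun q s => L (q.1.1 - s * ρ q) (q.1.2 - s • w q) +
    K * (q.1.1 - s * ρ q) ≤ L q.1.1 q.1.2 + K * q.1.1 - κ * s
  let t : D → Set ℝ := fun p => {h | (0 < h ∧ h ≤ 1 / 2) ∧ ∀ s, 0 ≤ s → s ≤ h → P p s}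
  have hconv (p : D) : Convex ℝ (t p) := by
    rw [convex_iff_ordConnected]
    refine ⟨fun x hx y hy z hz => ⟨⟨hx.1.1.trans_le hz.1, hz.2.trans hy.1.2⟩, fun s hs hsz => ?_⟩⟩
    exact hy.2 s hs (hsz.trans hz.2)
  have hloc (p : D) : ∃ h : ℝ, ∀ᶠ q in 𝓝 p, h ∈ t q := by
    have hs := hL.hasStrictFDerivAt (hD p.2).1 (ne_zero_of_mem_unitSphere (hD p.2).2)
    set A := fderiv ℝ (Function.uncurry L) (p.1.1, p.1.2) with hA
    let gap := A (ρ p, w p) + K * ρ p - κ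
    have hgap : 0 < gap := sub_pos.2 (hκ p)
    -- Strict differentiability is what makes the first-order estimate uniform in the base point q
    -- near p.
    have h1 := hs.isLittleO.def (half_pos hgap)
    have h2 : Tendsto (fun z : D × ℝ => ((z.1.1.1 - z.2 * ρ z.1, z.1.1.2 - z.2 • w z.1),
        (z.1 : ℝ × X))) (𝓝 (p, 0)) (𝓝 ((p.1.1, p.1.2), (p.1.1, p.1.2))) := by
      have : Continuous fun z : D × ℝ => ((z.1.1.1 - z.2 * ρ z.1, z.1.1.2 - z.2 • w z.1),
        (z.1 : ℝ × X)) := by fun_prop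
      convert this.tendsto (p, 0) using 2
      simp
    have h3 := h2.eventually h1
    rw [nhds_prod_eq, eventually_prod_iff] at h3
    obtain ⟨pa, hpa, pb, hpb, hab⟩ := h3
    obtain ⟨r, hr, hrb⟩ := Metric.eventually_nhds_iff.1 hpb
    have h4 : ∀ᶠ q in 𝓝 p, κ + gap / 2 < A (ρ q, w q) + K * ρ q := by
      have : Continuous fun q => A (ρ q, w q) + K * ρ q := by fun_prop
      refine this.continuousAt.eventually (lt_mem_nhds ?_)
      simp only [gap] at hgap ⊢
      linarith
    refine ⟨min (1 / 2) (r / 2), ?_⟩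
    filter_upwards [hpa, h4] with q hq1 hq2
    refine ⟨⟨by positivity, min_le_left _ _⟩, fun s hs0 hsr => ?_⟩
    have hsr' : dist s 0 < r := by
      rw [Real.dist_0_eq_abs, abs_of_nonneg hs0]
      linarith [min_le_right (1 / 2) (r / 2)]
    have h5 := hab hq1 (hrb hsr')
    have h6 : ((q.1.1 - s * ρ q, q.1.2 - s • w q) : ℝ × X) - (q : ℝ × X) = (-s) • (ρ q, w q) := by
      ext <;> simp
    have h7 : ‖(-s) • (ρ q, w q)‖ ≤ s := by
      rw [norm_smul, norm_neg, Real.norm_eq_abs, abs_of_nonneg hs0]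
      refine mul_le_of_le_one_right hs0 (max_le ?_ (hw q))
      rw [Real.norm_eq_abs, abs_of_pos (hρ0 q)]
      exact hρ1 q
    simp only [h6, map_smul, smul_eq_mul] at h5
    have h8 := (le_abs_self _).trans h5
    have h9 : gap / 2 * ‖(-s) • (ρ q, w q)‖ ≤ gap / 2 * s :=
      mul_le_mul_of_nonneg_left h7 (half_pos hgap).le
    have h10 : s * (κ + gap / 2) ≤ s * (A (ρ q, w q) + K * ρ q) :=
      mul_le_mul_of_nonneg_left hq2.le hs0
    have h11 : L (q.1.1 - s * ρ q) (q.1.2 - s • w q) - L q.1.1 q.1.2 - -s * A (ρ q, w q) ≤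
        gap / 2 * ‖(-s) • (ρ q, w q)‖ := h8
    change _ ≤ _
    nlinarith
  obtain ⟨h, hh⟩ := exists_continuous_forall_mem_convex_of_local_const hconv hloc
  let σ : D → D := fun p => ⟨(p.1.1, -p.1.2), hsymm p p.2⟩
  have hσ : Continuous σ := by
    refine Continuous.subtype_mk ?_ _
    fun_prop
  have hσσ (p : D) : σ (σ p) = p := Subtype.ext (Prod.ext rfl (neg_neg _))
  refine ⟨⟨fun p => min (h p) (h (σ p)), by fun_prop⟩, fun p => lt_min (hh p).1.1 (hh (σ p)).1.1,
    fun p => (min_le_left _ _).trans (hh p).1.2, ?_, ?_⟩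
  · rintro p q s hs0 hs (rfl | hq)
    · exact (hh q).2 s hs0 (hs.trans (min_le_left _ _))
    · obtain rfl : q = σ p := Subtype.ext hq
      exact (hh (σ p)).2 s hs0 (hs.trans (min_le_right _ _))
  · intro p q hq
    obtain rfl : q = σ p := Subtype.ext hq
    simp only [ContinuousMap.coe_mk, hσσ]
    exact min_comm _ _

/-- A set of the genus family at the parameter `c₂` is deformed to one at the parameter `c₁ ≤ c₂`
along which `L c u + (M + 1) c` does not exceed its bound. -/
theorem exists_mem_genusFamily_transfer [CompleteSpace X] (hL : IsSphericalFamily I L)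
    {c₁ c₂ : ℝ} (hle : c₁ ≤ c₂) (hI : Icc c₁ c₂ ⊆ I) {m M ε B : ℝ} (hM : 0 < M) (hε : 0 < ε)
    (hm : ∀ c ∈ Icc c₁ c₂, ∀ u ∈ unitSphere X, m ≤ L c u)
    (hdich : ∀ c ∈ Icc c₁ c₂, ∀ u ∈ unitSphere X, L c u + (M + 1) * c ≤ B →
      ε ≤ ‖sphereDeriv (L c) u‖ ∨ |fderiv ℝ (Function.uncurry L) (c, u) (1, 0)| ≤ M)
    {n : ℕ} {F : Set X} (hF : F ∈ genusFamily X n)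
    (hFB : ∀ u ∈ F, L c₂ u + (M + 1) * c₂ ≤ B) :
    ∃ F' ∈ genusFamily X n, ∀ u ∈ F', L c₁ u + (M + 1) * c₁ ≤ B := by
  let D : Set (ℝ × X) :=
    {p | p ∈ Icc c₁ c₂ ×ˢ unitSphere X ∧ L p.1 p.2 + (M + 1) * p.1 ≤ B}
  have hD : D ⊆ I ×ˢ unitSphere X := fun p hp => ⟨hI hp.1.1, hp.1.2⟩
  have hsymm : ∀ p ∈ D, (p.1, -p.2) ∈ D := fun p hp =>
    ⟨⟨hp.1.1, neg_mem_unitSphere hp.1.2⟩, by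
      simpa only [hL.even _ (hD hp).1 _ (ne_zero_of_mem_unitSphere (hD hp).2)] using hp.2⟩
  have hclosed : IsClosed D := by
    have hcont : ContinuousOn (fun p : ℝ × X => L p.1 p.2 + (M + 1) * p.1)
        (Icc c₁ c₂ ×ˢ unitSphere X) := by
      refine ContinuousOn.add (fun p hp => ?_) (by fun_prop)
      exact (hL.continuousAt (hI hp.1) (ne_zero_of_mem_unitSphere hp.2)).continuousWithinAt
    exact hcont.preimage_isClosed_of_isClosed (isClosed_Icc.prod Metric.isClosed_sphere) isClosed_Iic
  have : CompleteSpace D := hclosed.completeSpace_coe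
  obtain ⟨κ, hκ, ρ, w, hρ0, hρ1, hw, hV, hVσ⟩ := hL.exists_descent_field hD hsymm hε
    (fun p hp => hdich p.1 hp.1.1 p.2 hp.1.2 hp.2)
  obtain ⟨h, hh0, hh1, hdesc, hhσ⟩ := hL.exists_step_size hD hsymm ρ w hρ0 hρ1 hw hV
  -- The step is truncated so that the parameter never passes below c₁.
  let τ : D → ℝ := fun p => min (h p) ((p.1.1 - c₁) / ρ p)
  have hτ : Continuous τ :=
    h.continuous.min ((by fun_prop : Continuous fun p : D => p.1.1 - c₁).div ρ.continuous
      fun p => (hρ0 p).ne')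
  have hτ0 (p : D) : 0 ≤ τ p := le_min (hh0 p).le (div_nonneg (sub_nonneg.2 p.2.1.1.1) (hρ0 p).le)
  have hτh (p : D) : τ p ≤ h p := min_le_left _ _
  have hτc (p : D) : τ p * ρ p ≤ p.1.1 - c₁ := (le_div_iff₀ (hρ0 p)).1 (min_le_right _ _)
  let v : D → X := fun p => p.1.2 - τ p • w p
  have hv0 (p : D) : v p ≠ 0 := by
    intro h0
    have h1 : ‖τ p • w p‖ = 1 := by
      rw [← sub_eq_zero.1 h0]
      exact mem_unitSphere.1 p.2.1.2
    rw [norm_smul, Real.norm_eq_abs, abs_of_nonneg (hτ0 p)] at h1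
    have : τ p * ‖w p‖ ≤ 1 / 2 * 1 :=
      mul_le_mul ((hτh p).trans (hh1 p)) (hw p) (norm_nonneg _) (by norm_num)
    linarith
  have hc (p : D) : p.1.1 - τ p * ρ p ∈ Icc c₁ c₂ :=
    ⟨by linarith [hτc p], by linarith [mul_nonneg (hτ0 p) (hρ0 p).le, p.2.1.1.2]⟩
  have hψ (p : D) : L (p.1.1 - τ p * ρ p) (‖v p‖⁻¹ • v p) + (M + 1) * (p.1.1 - τ p * ρ p) ≤
      L p.1.1 p.1.2 + (M + 1) * p.1.1 - κ * τ p := by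
    -- Returning to the sphere does not change L, by 0-homogeneity.
    rw [hL.homogeneous _ (hI (hc p)) _ (hv0 p) _ (inv_pos.2 (norm_pos_iff.2 (hv0 p)))]
    exact hdesc p p (τ p) (hτ0 p) (hτh p) (Or.inl rfl)
  let Φ : D → D := fun p => ⟨(p.1.1 - τ p * ρ p, ‖v p‖⁻¹ • v p),
    ⟨hc p, normalize_mem_unitSphere (hv0 p)⟩,
    (hψ p).trans (by linarith [mul_nonneg hκ.le (hτ0 p), p.2.2])⟩
  have hv : Continuous v := by fun_prop
  have hΦ : Continuous Φ := by
    refine Continuous.subtype_mk (Continuous.prodMk (by fun_prop) ?_) _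
    exact continuousOn_normalize.comp_continuous hv hv0
  have hdist (p : D) : dist p (Φ p) ≤ 2 * τ p := by
    rw [Subtype.dist_eq, Prod.dist_eq]
    refine max_le ?_ ?_
    · have h1 : dist p.1.1 (p.1.1 - τ p * ρ p) = τ p * ρ p := by
        rw [Real.dist_eq, sub_sub_cancel, abs_of_nonneg (mul_nonneg (hτ0 p) (hρ0 p).le)]
      refine h1.le.trans ?_
      linarith [mul_le_of_le_one_right (hτ0 p) (hρ1 p), hτ0 p]
    · have h1 : dist p.1.2 (‖v p‖⁻¹ • v p) ≤ 2 * ‖p.1.2 - v p‖ := by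
        rw [dist_eq_norm]
        exact norm_sub_normalize_le (mem_unitSphere.1 p.2.1.2) (hv0 p)
      refine h1.trans ?_
      have h2 : ‖p.1.2 - v p‖ ≤ τ p := by
        simp only [v]
        rw [sub_sub_cancel, norm_smul, Real.norm_eq_abs, abs_of_nonneg (hτ0 p)]
        exact mul_le_of_le_one_right (hτ0 p) (hw p)
      linarith
  let σ : D → D := fun p => ⟨(p.1.1, -p.1.2), hsymm p p.2⟩
  have hσΦ : Function.Commute Φ σ := by
    intro p
    obtain ⟨h1, h2⟩ := hVσ p (σ p) rfl
    have h3 : τ (σ p) = τ p := by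
      simp only [τ]
      rw [hhσ p (σ p) rfl, h1]
    have h4 : v (σ p) = -v p := by
      change -p.1.2 - τ (σ p) • w (σ p) = -(p.1.2 - τ p • w p)
      rw [h3, h2, smul_neg]
      abel
    refine Subtype.ext (Prod.ext ?_ ?_)
    · change p.1.1 - τ (σ p) * ρ (σ p) = p.1.1 - τ p * ρ p
      rw [h3, h1]
    · change ‖v (σ p)‖⁻¹ • v (σ p) = -(‖v p‖⁻¹ • v p)
      rw [h4, norm_neg, smul_neg]
  let j : F → D := fun u => ⟨(c₂, u), ⟨⟨hle, le_rfl⟩, hF.1 u.2⟩, hFB u u.2⟩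
  have hj : Continuous j := by
    refine Continuous.subtype_mk ?_ _
    fun_prop
  have : CompactSpace F := isCompact_iff_compactSpace.1 hF.2.2.1
  -- W consists of the points whose untruncated step would overshoot c₁, so one step from W lands in
  -- T. Since h > 0, a vanishing τ forces the parameter to be c₁.
  obtain ⟨N, hN⟩ := exists_iterate_mem_of_descent hΦ
    (ψ := fun p => L p.1.1 p.1.2 + (M + 1) * p.1.1) (m := m + (M + 1) * c₁)
    hτ hτ0 hκ
    (fun p => add_le_add (hm _ p.2.1.1 _ p.2.1.2)
      (mul_le_mul_of_nonneg_left p.2.1.1.1 (by linarith)))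
    hdist hψ (T := {p | p.1.1 = c₁}) (W := {p | p.1.1 - c₁ < h p * ρ p})
    (isOpen_lt (by fun_prop) (by fun_prop))
    (fun p (hp : p.1.1 = c₁) => by
      change p.1.1 - c₁ < h p * ρ p
      rw [hp, sub_self]
      exact mul_pos (hh0 p) (hρ0 p))
    (fun p (hp : p.1.1 - c₁ < h p * ρ p) => by
      have h1 : τ p = (p.1.1 - c₁) / ρ p := min_eq_right ((div_lt_iff₀ (hρ0 p)).2 hp).le
      change p.1.1 - τ p * ρ p = c₁
      rw [h1, div_mul_cancel₀ _ (hρ0 p).ne', sub_sub_cancel])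
    (fun p hp => by
      change p.1.1 = c₁
      rcases min_choice (h p) ((p.1.1 - c₁) / ρ p) with h1 | h1
      · exact absurd (h1.symm.trans hp) (hh0 p).ne'
      · have h2 := (div_eq_zero_iff.1 (h1.symm.trans hp)).resolve_right (hρ0 p).ne'
        linarith)
    (isCompact_range hj)
  refine ⟨range fun u : F => (Φ^[N] (j u)).1.2, ?_, ?_⟩
  · refine range_mem_genusFamily hF _ ?_ (fun u => (Φ^[N] (j u)).2.1.2) ?_
    · exact continuous_snd.comp (continuous_subtype_val.comp ((hΦ.iterate N).comp hj))
    · intro u v huv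
      have h1 : j v = σ (j u) := Subtype.ext (Prod.ext rfl huv)
      change (Φ^[N] (j v)).1.2 = _
      rw [h1, (hσΦ.iterate_left N).eq (j u)]
  · rintro _ ⟨u, rfl⟩
    have h1 : (Φ^[N] (j u)).1.1 = c₁ := hN _ (mem_range_self u)
    have h2 := (Φ^[N] (j u)).2.2
    rw [h1] at h2
    exact h2

end IsSphericalFamily

end EnergyCurves

end

/-! ### Monotonicity and Lipschitz continuity of the minimax levels -/

noncomputable section

namespace EnergyCurves

variable {X : Type*} [NormedAddCommGroup X] [NormedSpace ℝ X]

namespace IsSphericalFamily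

variable {I : Set ℝ} {L : ℝ → X → ℝ}

theorem bddAbove_image (hL : IsSphericalFamily I L) {c : ℝ} (hc : c ∈ I) {n : ℕ} {F : Set X}
    (hF : F ∈ genusFamily X n) : BddAbove (L c '' F) := by
  refine (hF.2.2.1.image_of_continuousOn fun u hu => ContinuousAt.continuousWithinAt ?_).bddAbove
  exact ContinuousAt.comp (f := fun u : X => (c, u))
    (hL.continuousAt hc (ne_zero_of_mem_unitSphere (hF.1 hu))) (by fun_prop)

theorem minimax_le (hL : IsSphericalFamily I L) {c : ℝ} (hc : c ∈ I)
    (hbdd : BddBelow (L c '' unitSphere X)) {n : ℕ} {F : Set X} (hF : F ∈ genusFamily X n) {α : ℝ}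
    (hα : ∀ u ∈ F, L c u ≤ α) : minimax n (L c) ≤ α := by
  obtain ⟨m, hm⟩ := hbdd
  have h1 : BddBelow ((fun F : Set X => sSup (L c '' F)) '' genusFamily X n) := by
    refine ⟨m, ?_⟩
    rintro _ ⟨G, hG, rfl⟩
    obtain ⟨u, hu⟩ := hG.2.1
    exact (hm (mem_image_of_mem _ (hG.1 hu))).trans
      (le_csSup (hL.bddAbove_image hc hG) (mem_image_of_mem _ hu))
  refine (csInf_le h1 (mem_image_of_mem _ hF)).trans (csSup_le (hF.2.1.image _) ?_)
  rintro _ ⟨u, hu, rfl⟩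
  exact hα u hu

theorem exists_mem_genusFamily_le (hL : IsSphericalFamily I L) (hdim : ¬ FiniteDimensional ℝ X)
    {c : ℝ} (hc : c ∈ I) {n : ℕ} {α : ℝ} (hα : minimax n (L c) < α) :
    ∃ F ∈ genusFamily X n, ∀ u ∈ F, L c u ≤ α := by
  obtain ⟨_, ⟨F, hF, rfl⟩, hlt⟩ :=
    exists_lt_of_csInf_lt ((genusFamily_nonempty hdim n).image _) hα
  exact ⟨F, hF, fun u hu =>
    (le_csSup (hL.bddAbove_image hc hF) (mem_image_of_mem _ hu)).trans hlt.le⟩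

/-- Sets whose supremum is close to the minimax value lie in the sublevel α, so a comparison there
is enough. -/
theorem minimax_le_add (hL : IsSphericalFamily I L) (hdim : ¬ FiniteDimensional ℝ X)
    {c c' : ℝ} (hc : c ∈ I) (hc' : c' ∈ I) (hbdd : BddBelow (L c' '' unitSphere X)) {n : ℕ}
    {α r : ℝ} (hα : minimax n (L c) < α)
    (h : ∀ u ∈ unitSphere X, L c u ≤ α → L c' u ≤ L c u + r) :
    minimax n (L c') ≤ minimax n (L c) + r := by
  refine le_of_forall_gt_imp_ge_of_dense fun β hβ => ?_
  have h1 : minimax n (L c) < min (β - r) α := lt_min (by linarith) hα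
  obtain ⟨F, hF, hFu⟩ := hL.exists_mem_genusFamily_le hdim hc h1
  refine hL.minimax_le hc' hbdd hF fun u hu => ?_
  have h2 := hFu u hu
  linarith [h u (hF.1 hu) (h2.trans (min_le_right _ _)), h2.trans (min_le_left _ _)]

theorem antitoneOn_minimax (hL : IsSphericalFamily I L) (hdim : ¬ FiniteDimensional ℝ X)
    (hbdd : ∀ c ∈ I, BddBelow (L c '' unitSphere X)) (hdec : H3Decreasing I L) (n : ℕ) :
    AntitoneOn (fun c => minimax n (L c)) I := by
  intro c hc c' hc' hle
  have := hL.minimax_le_add hdim hc hc' (hbdd c' hc') (n := n) (lt_add_one _) (r := 0)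
    fun u hu _ => by
      rw [add_zero]
      exact (hdec.decreasing u hu).antitoneOn hc hc' hle
  simpa using this

theorem minimax_lt_of_Icc_subset (hL : IsSphericalFamily I L) (hdim : ¬ FiniteDimensional ℝ X)
    (hbdd : ∀ c ∈ I, BddBelow (L c '' unitSphere X)) (hdec : H3Decreasing I L) (n : ℕ)
    {c c' : ℝ} (hlt : c < c') (hI : Icc c c' ⊆ I) : minimax n (L c') < minimax n (L c) := by
  have hc : c ∈ I := hI (left_mem_Icc.2 hlt.le)
  have hc' : c' ∈ I := hI (right_mem_Icc.2 hlt.le)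
  obtain ⟨b, hb⟩ := hbdd c' hc'
  -- On this sublevel set at c, monotonicity in the parameter bounds Λ over [c,c']: above by α,
  -- below by its lower bound b at c'. This is the input that (H3) requires.
  let α := minimax n (L c) + 1
  obtain ⟨m, M, hm, hmM⟩ := hdec.partialBound c c' {u | u ∈ unitSphere X ∧ L c u ≤ α} hI
    (fun u hu => hu.1) ⟨max |b| |α|, fun s hs u hu => abs_le_max_abs_abs
      ((hb (mem_image_of_mem _ hu.1)).trans
        ((hdec.decreasing u hu.1).antitoneOn (hI hs) hc' hs.2))
      (((hdec.decreasing u hu.1).antitoneOn hc (hI hs) hs.1).trans hu.2)⟩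
  have key := hL.minimax_le_add hdim hc hc' (hbdd c' hc') (n := n) (lt_add_one _)
    (r := -(m * (c' - c))) fun u hu hα => by
      obtain ⟨ξ, hξ, hmean⟩ := exists_deriv_eq_slope (fun s => L s u) hlt
        (fun s hs => (hL.hasDerivAt_left (hI hs)
          (ne_zero_of_mem_unitSphere hu)).continuousAt.continuousWithinAt)
        (fun s hs => (hL.hasDerivAt_left (hI (Ioo_subset_Icc_self hs))
          (ne_zero_of_mem_unitSphere hu)).differentiableAt.differentiableWithinAt)
      have h1 := (hmM ξ (Ioo_subset_Icc_self hξ) u ⟨hu, hα⟩).1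
      have h2 : L c' u < L c u := hdec.decreasing u hu hc hc' hlt
      rw [hmean, abs_div, abs_of_neg (sub_neg.2 h2), abs_of_pos (sub_pos.2 hlt),
        le_div_iff₀ (sub_pos.2 hlt)] at h1
      linarith
  have := mul_pos hm (sub_pos.2 hlt)
  linarith

theorem strictAntiOn_minimax (hL : IsSphericalFamily I L) (hdim : ¬ FiniteDimensional ℝ X)
    (hbdd : ∀ c ∈ I, BddBelow (L c '' unitSphere X)) (hdec : H3Decreasing I L) (n : ℕ) :
    StrictAntiOn (fun c => minimax n (L c)) I := by
  intro c hc c' hc' hlt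
  -- I need not be an interval: a short step to the right inside I is strict, and the remaining
  -- comparison is weak monotonicity.
  obtain ⟨δ, hδ, hball⟩ := Metric.isOpen_iff.1 hL.isOpen c hc
  have h1 : c < min c' (c + δ / 2) := lt_min hlt (by linarith)
  have hI : Icc c (min c' (c + δ / 2)) ⊆ I := fun s hs => hball (by
    rw [Metric.mem_ball, Real.dist_eq, abs_of_nonneg (sub_nonneg.2 hs.1)]
    linarith [hs.2.trans (min_le_right _ _)])
  exact (hL.antitoneOn_minimax hdim hbdd hdec n (hI (right_mem_Icc.2 h1.le)) hc'
    (min_le_left _ _)).trans_lt (hL.minimax_lt_of_Icc_subset hdim hbdd hdec n h1 hI)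

theorem locallyLipschitzOn_minimax [CompleteSpace X] (hL : IsSphericalFamily I L)
    (hdim : ¬ FiniteDimensional ℝ X) (hPSG : PSG I L)
    (hbdd : ∀ c ∈ I, BddBelow (L c '' unitSphere X)) (hdec : H3Decreasing I L) (n : ℕ) :
    LocallyLipschitzOn I (fun c => minimax n (L c)) := by
  intro c₀ hc₀
  obtain ⟨δ, hδ, hball⟩ := Metric.nhds_basis_closedBall.mem_iff.1 (hL.isOpen.mem_nhds hc₀)
  rw [Real.closedBall_eq_Icc] at hball
  have hl : c₀ - δ ∈ I := hball (left_mem_Icc.2 (by linarith))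
  have hr : c₀ + δ ∈ I := hball (right_mem_Icc.2 (by linarith))
  obtain ⟨m, hm⟩ := hbdd _ hr
  have hm' : ∀ c ∈ Icc (c₀ - δ) (c₀ + δ), ∀ u ∈ unitSphere X, m ≤ L c u := fun c hc u hu =>
    (hm (mem_image_of_mem _ hu)).trans ((hdec.decreasing u hu).antitoneOn (hball hc) hr hc.2)
  obtain ⟨M, hM, ε, hε, hdich⟩ := hL.exists_bound_or_gradient hPSG hc₀ (m := m)
    (eventually_of_mem (Icc_mem_nhds (by linarith) (by linarith)) hm')
    -- The 2 is room for η ≤ 1 and for (M+1)(c₂ − c) ≤ 1 along the deformation; `r` is chosen for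
    -- the latter.
    (minimax n (L (c₀ - δ)) + 2)
  obtain ⟨δ', hδ', hdich'⟩ := Metric.eventually_nhds_iff.1 hdich
  have hM1 : 0 < M + 1 := by linarith
  let r := min (min δ δ') (1 / (2 * (M + 1)))
  have hr0 : 0 < r := by positivity
  have hrδ : r ≤ δ := (min_le_left _ _).trans (min_le_left _ _)
  have hrδ' : r ≤ δ' := (min_le_left _ _).trans (min_le_right _ _)
  have hrM : (M + 1) * (2 * r) ≤ 1 := by
    have := (le_div_iff₀ (by positivity : 0 < 2 * (M + 1))).1
      (min_le_right (min δ δ') (1 / (2 * (M + 1))))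
    linarith
  have hsub : Ioo (c₀ - r) (c₀ + r) ⊆ Icc (c₀ - δ) (c₀ + δ) := fun c hc =>
    ⟨by linarith [hc.1], by linarith [hc.2]⟩
  have key : ∀ c₁ ∈ Ioo (c₀ - r) (c₀ + r), ∀ c₂ ∈ Ioo (c₀ - r) (c₀ + r), c₁ ≤ c₂ →
      minimax n (L c₁) ≤ minimax n (L c₂) + (M + 1) * (c₂ - c₁) := by
    intro c₁ hc₁ c₂ hc₂ hle
    have hIoo : Icc c₁ c₂ ⊆ Ioo (c₀ - r) (c₀ + r) := fun c hc =>
      ⟨hc₁.1.trans_le hc.1, hc.2.trans_lt hc₂.2⟩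
    have hanti : minimax n (L c₂) ≤ minimax n (L (c₀ - δ)) :=
      hL.antitoneOn_minimax hdim hbdd hdec n hl (hball (hsub hc₂)) (hsub hc₂).1
    refine le_of_forall_gt_imp_ge_of_dense fun β hβ => ?_
    let η := min 1 (β - (minimax n (L c₂) + (M + 1) * (c₂ - c₁)))
    have hη : 0 < η := lt_min one_pos (sub_pos.2 hβ)
    obtain ⟨F, hF, hFu⟩ := hL.exists_mem_genusFamily_le hdim (hball (hsub hc₂))
      (lt_add_of_pos_right (minimax n (L c₂)) hη)
    obtain ⟨F', hF', hFu'⟩ := hL.exists_mem_genusFamily_transfer hle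
      (fun c hc => hball (hsub (hIoo hc))) hM hε (fun c hc => hm' c (hsub (hIoo hc)))
      (B := minimax n (L c₂) + η + (M + 1) * c₂) (fun c hc u hu hB => by
        have hcr := hIoo hc
        refine hdich' ?_ u hu ?_
        · rw [Real.dist_eq, abs_lt]
          constructor <;> linarith [hcr.1, hcr.2]
        · have h1 : (M + 1) * (c₂ - c) ≤ (M + 1) * (2 * r) :=
            mul_le_mul_of_nonneg_left (by linarith [hcr.1, hc₂.2]) hM1.le
          have h2 : η ≤ 1 := min_le_left _ _
          linarith)
      hF (fun u hu => add_le_add_left (hFu u hu) _)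
    refine hL.minimax_le (hball (hsub hc₁)) (hbdd _ (hball (hsub hc₁))) hF' fun u hu => ?_
    have h1 := hFu' u hu
    have h2 : η ≤ β - (minimax n (L c₂) + (M + 1) * (c₂ - c₁)) := min_le_right _ _
    linarith
  refine ⟨(M + 1).toNNReal, Ioo (c₀ - r) (c₀ + r),
    mem_nhdsWithin_of_mem_nhds (Ioo_mem_nhds (by linarith) (by linarith)),
    LipschitzOnWith.of_dist_le_mul fun c₁ hc₁ c₂ hc₂ => ?_⟩
  rw [Real.coe_toNNReal _ hM1.le]
  wlog hle : c₁ ≤ c₂ generalizing c₁ c₂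
  · rw [dist_comm, dist_comm c₁]
    exact this c₂ hc₂ c₁ hc₁ (le_of_not_ge hle)
  have hanti : minimax n (L c₂) ≤ minimax n (L c₁) :=
    hL.antitoneOn_minimax hdim hbdd hdec n (hball (hsub hc₁)) (hball (hsub hc₂)) hle
  rw [Real.dist_eq, abs_of_nonneg (sub_nonneg.2 hanti), dist_comm, Real.dist_eq,
    abs_of_nonneg (sub_nonneg.2 hle)]
  linarith [key c₁ hc₁ c₂ hc₂ hle]

end IsSphericalFamily

end EnergyCurves

end

/-! ### Change of sign, and reduction of Λ to a spherical family -/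

noncomputable section

namespace EnergyCurves

variable {X : Type*} [NormedAddCommGroup X]

theorem PartialBound.neg {I : Set ℝ} {L : ℝ → X → ℝ} (h : PartialBound I L) :
    PartialBound I fun c u => -L c u := by
  intro a b S₀ hI hS hbd
  simpa only [deriv.fun_neg, abs_neg] using h a b S₀ hI hS (by simpa only [abs_neg] using hbd)

theorem H3Increasing.neg {I : Set ℝ} {L : ℝ → X → ℝ} (h : H3Increasing I L) :
    H3Decreasing I fun c u => -L c u where
  decreasing u hu := (h.increasing u hu).neg
  bddAbove K hK hc := by
    obtain ⟨b, hb⟩ := h.bddBelow K hK hc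
    refine ⟨-b, ?_⟩
    rintro _ ⟨p, hp, rfl⟩
    exact neg_le_neg (hb (mem_image_of_mem _ hp))
  partialBound := h.partialBound.neg

variable [NormedSpace ℝ X]

section Negation

open scoped Pointwise in
theorem minimax_neg (n : ℕ) (f : X → ℝ) : minimax n (fun u => -f u) = -maximin n f := by
  have h1 (F : Set X) : sSup ((fun u => -f u) '' F) = -sInf (f '' F) := by
    rw [← Real.sSup_neg, ← image_neg_eq_neg, image_image]
  simp only [minimax, maximin, h1]
  rw [← Real.sInf_neg, ← image_neg_eq_neg, image_image]

theorem norm_sphereDeriv_neg (f : X → ℝ) (u : X) :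
    ‖sphereDeriv (fun v => -f v) u‖ = ‖sphereDeriv f u‖ := by
  have h : sphereDeriv (fun v => -f v) u = -sphereDeriv f u := by
    rw [sphereDeriv, sphereDeriv, fderiv_fun_neg, ContinuousLinearMap.neg_comp]
  rw [h]
  exact norm_neg (sphereDeriv f u)

theorem PSG.neg {I : Set ℝ} {L : ℝ → X → ℝ} (h : PSG I L) : PSG I fun c u => -L c u := by
  intro c cs w hc hcs hlim hw hbd hder
  refine h c cs w hc hcs hlim hw ?_ ?_
  · simpa only [abs_neg] using hbd
  · simpa only [norm_sphereDeriv_neg] using hder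

theorem IsSphericalFamily.neg {I : Set ℝ} {L : ℝ → X → ℝ} (h : IsSphericalFamily I L) :
    IsSphericalFamily I fun c u => -L c u where
  isOpen := h.isOpen
  contDiffOn := h.contDiffOn.neg
  even c hc u hu := congrArg _ (h.even c hc u hu)
  homogeneous c hc u hu s hs := congrArg _ (h.homogeneous c hc u hu s hs)

theorem isMorseMin_neg_iff {f : ℝ → ℝ} {s : ℝ} :
    IsMorseMin (fun r => -f r) s ↔ IsMorseMax f s := by
  have h1 : IsLocalMin (fun r => -f r) s ↔ IsLocalMax f s :=
    ⟨fun h => by simpa using h.neg, fun h => h.neg⟩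
  have h2 : deriv (fun r => -f r) = fun r => -deriv f r := funext fun r => deriv.fun_neg
  rw [IsMorseMin, IsMorseMax, h1, h2, deriv.fun_neg, neg_ne_zero]

/-- Changing the sign of `I₂` turns the maximizer alternative of (H1) into the minimizer one. -/
theorem psi_neg (I₁ I₂ : X → ℝ) (c : ℝ) (u : X) :
    psi I₁ (fun v => -I₂ v) c u = fun s => -psi I₁ I₂ c u s := by
  funext s
  simp only [psi, mu, div_neg]

end Negation

theorem isMorseMin_comp_mul_iff {f : ℝ → ℝ} {a s : ℝ} (ha : 0 < a) :
    IsMorseMin (fun r => f (a * r)) s ↔ IsMorseMin f (a * s) := by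
  have hd : deriv (fun r => f (a * r)) = fun r => a * deriv f (a * r) := by
    funext r
    exact deriv_comp_mul_left a f r
  have hdd : deriv (deriv fun r => f (a * r)) s = a * (a * deriv (deriv f) (a * s)) := by
    rw [hd, deriv_const_mul_field]
    congr 1
    exact deriv_comp_mul_left a (deriv f) s
  have hloc : IsLocalMin (fun r => f (a * r)) s ↔ IsLocalMin f (a * s) := by
    have hmap : map (fun r => a * r) (𝓝 s) = 𝓝 (a * s) :=
      (Homeomorph.mulLeft₀ a ha.ne').map_nhds_eq s
    rw [IsLocalMin, IsLocalMin, IsMinFilter, IsMinFilter, ← hmap, eventually_map]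
  rw [IsMorseMin, IsMorseMin, hloc, hdd, mul_pos_iff_of_pos_left ha, mul_ne_zero_iff,
    mul_ne_zero_iff]
  simp [ha.ne']

section Reduction

variable {I₁ I₂ : X → ℝ} {I : Set ℝ} {t : ℝ → X → ℝ}

theorem contDiffAt_psi (hI₁ : ContDiff ℝ 1 I₁) (hI₂ : ContDiff ℝ 1 I₂)
    (hI₂ne : ∀ u, u ≠ 0 → I₂ u ≠ 0) {c : ℝ} {u : X} {s : ℝ} (hu : u ≠ 0) (hs : s ≠ 0) :
    ContDiffAt ℝ 1 (fun q : (ℝ × X) × ℝ => psi I₁ I₂ q.1.1 q.1.2 q.2) ((c, u), s) := by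
  have h1 : ContDiff ℝ 1 fun q : (ℝ × X) × ℝ => q.2 • q.1.2 :=
    contDiff_snd.smul (contDiff_snd.comp contDiff_fst)
  exact (((hI₁.comp h1).sub (contDiff_fst.comp contDiff_fst)).contDiffAt).div
    (hI₂.comp h1).contDiffAt (hI₂ne _ (smul_ne_zero hs hu))

theorem continuousAt_psi (hI₁ : ContDiff ℝ 1 I₁) (hI₂ : ContDiff ℝ 1 I₂)
    (hI₂ne : ∀ u, u ≠ 0 → I₂ u ≠ 0) {c : ℝ} {u : X} {s : ℝ} (hu : u ≠ 0) (hs : s ≠ 0) :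
    ContinuousAt (psi I₁ I₂ c u) s :=
  ContinuousAt.comp (f := fun s : ℝ => ((c, u), s))
    (contDiffAt_psi hI₁ hI₂ hI₂ne hu hs).continuousAt (by fun_prop)

/-- A negative second derivative would make s a local maximum too, so f would be locally constant
with zero second derivative. -/
theorem deriv_deriv_pos_of_isMorseMin {f : ℝ → ℝ} {s : ℝ} (hf : ContinuousAt f s)
    (h : IsMorseMin f s) : 0 < deriv (deriv f) s := by
  obtain ⟨-, hmin, hne⟩ := h
  by_contra! hle
  have hmax := isLocalMax_of_deriv_deriv_neg (lt_of_le_of_ne hle hne) hmin.deriv_eq_zero hf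
  have hconst : f =ᶠ[𝓝 s] fun _ => f s := by
    filter_upwards [hmin, hmax] with r h1 h2
    exact le_antisymm h2 h1
  have h2 : deriv f =ᶠ[𝓝 s] fun _ => 0 := by
    simpa using hconst.deriv
  exact hne (by simpa using h2.deriv_eq)

/-- Near a point of the family, the Morse minimizer is given by a `C¹` function. -/
theorem exists_contDiffAt_eventuallyEq_minimizer [CompleteSpace X] (hI₁ : ContDiff ℝ 1 I₁)
    (hI₂ : ContDiff ℝ 1 I₂) (hI₂ne : ∀ u, u ≠ 0 → I₂ u ≠ 0) (hI : IsOpen I)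
    (hG : ContDiffOn ℝ 1 (fun p : ℝ × X × ℝ => deriv (psi I₁ I₂ p.1 p.2.1) p.2.2)
      (I ×ˢ ({0}ᶜ : Set X) ×ˢ Ioi (0 : ℝ)))
    (hmin : ∀ c ∈ I, ∀ u : X, u ≠ 0 → ∀ s : ℝ, IsMorseMin (psi I₁ I₂ c u) s ↔ s = t c u)
    {c : ℝ} {u : X} (hc : c ∈ I) (hu : u ≠ 0) :
    ∃ φ : ℝ × X → ℝ, ContDiffAt ℝ 1 φ (c, u) ∧ Function.uncurry t =ᶠ[𝓝 (c, u)] φ := by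
  let G : (ℝ × X) × ℝ → ℝ := fun q => deriv (psi I₁ I₂ q.1.1 q.1.2) q.2
  have hopen : IsOpen (I ×ˢ ({0}ᶜ : Set X) ×ˢ Ioi (0 : ℝ)) :=
    hI.prod (isOpen_compl_singleton.prod isOpen_Ioi)
  have hGat (c : ℝ) (u : X) (s : ℝ) (hc : c ∈ I) (hu : u ≠ 0) (hs : 0 < s) :
      ContDiffAt ℝ 1 G ((c, u), s) := by
    have h1 : ContDiffAt ℝ 1 (fun p : ℝ × X × ℝ => deriv (psi I₁ I₂ p.1 p.2.1) p.2.2) (c, u, s) :=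
      hG.contDiffAt (hopen.mem_nhds (mk_mem_prod hc (mk_mem_prod hu hs)))
    have h2 : ContDiff ℝ 1 fun q : (ℝ × X) × ℝ => (q.1.1, q.1.2, q.2) := by fun_prop
    exact ContDiffAt.comp (f := fun q : (ℝ × X) × ℝ => (q.1.1, q.1.2, q.2)) ((c, u), s) h1
      h2.contDiffAt
  have hGs (c : ℝ) (u : X) (s : ℝ) (hc : c ∈ I) (hu : u ≠ 0) (hs : 0 < s) :
      fderiv ℝ G ((c, u), s) (0, 1) = deriv (deriv (psi I₁ I₂ c u)) s := by
    have h1 : HasDerivAt (fun r : ℝ => ((c, u), r)) (0, 1) s :=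
      (hasDerivAt_const s (c, u)).prodMk (hasDerivAt_id s)
    have h2 := HasFDerivAt.comp_hasDerivAt (f := fun r : ℝ => ((c, u), r)) s
      ((hGat c u s hc hu hs).differentiableAt one_ne_zero).hasFDerivAt h1
    exact h2.deriv.symm
  set s₀ := t c u with hs₀
  have hM := (hmin c hc u hu s₀).2 rfl
  have hpos := deriv_deriv_pos_of_isMorseMin
    (continuousAt_psi hI₁ hI₂ hI₂ne hu hM.1.ne') hM
  have hG0 : G ((c, u), s₀) = 0 := hM.2.1.deriv_eq_zero
  have cdf := hGat c u s₀ hc hu hM.1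
  have hinv : (fderiv ℝ G ((c, u), s₀) ∘L .inr ℝ (ℝ × X) ℝ).IsInvertible := by
    refine ⟨ContinuousLinearEquiv.unitsEquivAut ℝ (Units.mk0 _ hpos.ne'), ?_⟩
    ext
    simp [hGs c u s₀ hc hu hM.1]
  refine ⟨cdf.implicitFunction one_ne_zero hinv, cdf.contDiffAt_implicitFunction one_ne_zero hinv,
    ?_⟩
  have hlim : Tendsto (fun p => (p, cdf.implicitFunction one_ne_zero hinv p)) (𝓝 (c, u))
      (𝓝 ((c, u), s₀)) := by
    have h1 := (cdf.contDiffAt_implicitFunction one_ne_zero hinv).continuousAt.tendsto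
    rw [cdf.implicitFunction_apply_self] at h1
    exact tendsto_id.prodMk_nhds h1
  have hpos' : ∀ᶠ q in 𝓝 ((c, u), s₀), 0 < fderiv ℝ G q (0, 1) := by
    have h1 : ContinuousAt (fun q => fderiv ℝ G q (0, 1)) ((c, u), s₀) :=
      (cdf.continuousAt_fderiv one_ne_zero).clm_apply continuousAt_const
    refine h1.eventually (lt_mem_nhds ?_)
    exact hpos.trans_eq (hGs c u s₀ hc hu hM.1).symm
  have hdom : ∀ᶠ q : (ℝ × X) × ℝ in 𝓝 ((c, u), s₀), q.1.1 ∈ I ∧ q.1.2 ≠ 0 ∧ 0 < q.2 := by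
    have h1 : IsOpen ((I ×ˢ ({0}ᶜ : Set X)) ×ˢ Ioi (0 : ℝ)) :=
      (hI.prod isOpen_compl_singleton).prod isOpen_Ioi
    filter_upwards [h1.mem_nhds (mk_mem_prod (mk_mem_prod hc hu) hM.1)] with q hq
    exact ⟨hq.1.1, hq.1.2, hq.2⟩
  filter_upwards [hlim.eventually hpos', hlim.eventually hdom,
    cdf.eventually_apply_implicitFunction one_ne_zero hinv] with p hp1 hp2 hp3
  obtain ⟨hpc, hpu, hps⟩ := hp2
  rw [hG0] at hp3
  rw [show p = (p.1, p.2) from rfl, hGs p.1 p.2 _ hpc hpu hps] at hp1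
  -- The implicit solution is a critical point with positive second derivative, hence a Morse
  -- minimizer, and uniqueness identifies it with t. No continuity of t is assumed beforehand.
  symm
  refine (hmin p.1 hpc p.2 hpu _).1 ⟨hps, ?_, hp1.ne'⟩
  exact isLocalMin_of_deriv_deriv_pos hp1 hp3 (continuousAt_psi hI₁ hI₂ hI₂ne hpu hps.ne')

/-- Uniqueness transfers the symmetries of ψ to the minimizer: t(c,−u) = t(c,u) and a·t(c,au) =
t(c,u). -/
theorem isSphericalFamily_Lam_of_min [CompleteSpace X] (hI₁ : ContDiff ℝ 1 I₁)
    (hI₂ : ContDiff ℝ 1 I₂) (hI₁even : ∀ u, I₁ (-u) = I₁ u) (hI₂even : ∀ u, I₂ (-u) = I₂ u)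
    (hI₂ne : ∀ u, u ≠ 0 → I₂ u ≠ 0) (hI : IsOpen I)
    (hG : ContDiffOn ℝ 1 (fun p : ℝ × X × ℝ => deriv (psi I₁ I₂ p.1 p.2.1) p.2.2)
      (I ×ˢ ({0}ᶜ : Set X) ×ˢ Ioi (0 : ℝ)))
    (hmin : ∀ c ∈ I, ∀ u : X, u ≠ 0 → ∀ s : ℝ, IsMorseMin (psi I₁ I₂ c u) s ↔ s = t c u) :
    IsSphericalFamily I (Lam I₁ I₂ t) where
  isOpen := hI
  contDiffOn := by
    rintro ⟨c, u⟩ ⟨hc, hu⟩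
    obtain ⟨φ, hφ, heq⟩ :=
      exists_contDiffAt_eventuallyEq_minimizer hI₁ hI₂ hI₂ne hI hG hmin hc hu
    have hs : 0 < φ (c, u) := by
      rw [← heq.eq_of_nhds]
      exact ((hmin c hc u hu _).2 rfl).1
    have h1 : ContDiffAt ℝ 1 (fun p : ℝ × X => psi I₁ I₂ p.1 p.2 (φ p)) (c, u) :=
      ContDiffAt.comp (f := fun p : ℝ × X => (p, φ p)) (c, u)
        (contDiffAt_psi hI₁ hI₂ hI₂ne hu hs.ne') (contDiffAt_id.prodMk hφ)
    refine (h1.congr_of_eventuallyEq ?_).contDiffWithinAt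
    filter_upwards [heq] with p hp
    change psi I₁ I₂ p.1 p.2 (Function.uncurry t p) = _
    rw [hp]
  even c hc u hu := by
    have hpsi : psi I₁ I₂ c (-u) = psi I₁ I₂ c u := by
      funext s
      simp only [psi, mu, smul_neg, hI₁even, hI₂even]
    have ht : t c (-u) = t c u := by
      rw [← hmin c hc u hu, ← hpsi]
      exact (hmin c hc (-u) (neg_ne_zero.2 hu) _).2 rfl
    rw [Lam, Lam, hpsi, ht]
  homogeneous c hc u hu a ha := by
    have hpsi : psi I₁ I₂ c (a • u) = fun s => psi I₁ I₂ c u (a * s) := by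
      funext s
      simp only [psi, smul_smul, mul_comm a]
    have ht : a * t c (a • u) = t c u := by
      rw [← hmin c hc u hu, ← isMorseMin_comp_mul_iff ha, ← hpsi]
      exact (hmin c hc (a • u) (smul_ne_zero ha.ne' hu) _).2 rfl
    rw [Lam, Lam, hpsi, ← ht]

theorem isSphericalFamily_Lam [CompleteSpace X] (hI₁ : ContDiff ℝ 1 I₁)
    (hI₂ : ContDiff ℝ 1 I₂) (hI₁even : ∀ u, I₁ (-u) = I₁ u) (hI₂even : ∀ u, I₂ (-u) = I₂ u)
    (hI₂ne : ∀ u, u ≠ 0 → I₂ u ≠ 0) (h1 : H1 I₁ I₂ I t) :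
    IsSphericalFamily I (Lam I₁ I₂ t) := by
  rcases h1.extremum with hmin | hmax
  · exact isSphericalFamily_Lam_of_min hI₁ hI₂ hI₁even hI₂even hI₂ne h1.isOpen h1.contDiffOn hmin
  · have h2 : IsSphericalFamily I (Lam I₁ (fun v => -I₂ v) t) := by
      refine isSphericalFamily_Lam_of_min hI₁ hI₂.neg hI₁even
        (fun u => congrArg _ (hI₂even u)) (fun u hu => neg_ne_zero.2 (hI₂ne u hu)) h1.isOpen ?_ ?_
      · simp only [psi_neg, deriv.fun_neg]
        exact h1.contDiffOn.neg
      · intro c hc u hu s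
        rw [psi_neg, isMorseMin_neg_iff]
        exact hmax c hc u hu s
    have h3 : Lam I₁ I₂ t = fun c u => -Lam I₁ (fun v => -I₂ v) t c u := by
      funext c u
      simp only [Lam, psi_neg, neg_neg]
    rw [h3]
    exact h2.neg

end Reduction

end EnergyCurves

end

theorem theorem1p4 {X : Type*} [NormedAddCommGroup X] [NormedSpace ℝ X] [CompleteSpace X]
    [UniformConvexSpace X] (hdim : ¬ FiniteDimensional ℝ X)
    (hnorm : ContDiffOn ℝ 1 (fun u : X => ‖u‖) {0}ᶜ)
    (I₁ I₂ : X → ℝ) (hI₁ : ContDiff ℝ 1 I₁) (hI₂ : ContDiff ℝ 1 I₂)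
    (hI₁even : ∀ u, I₁ (-u) = I₁ u) (hI₂even : ∀ u, I₂ (-u) = I₂ u)
    (hI₂ne : ∀ u, u ≠ 0 → I₂ u ≠ 0)
    (I : Set ℝ) (t : ℝ → X → ℝ) (h1 : EnergyCurves.H1 I₁ I₂ I t)
    (hPSG : EnergyCurves.PSG I (EnergyCurves.Lam I₁ I₂ t)) :
    (EnergyCurves.H2Below I (EnergyCurves.Lam I₁ I₂ t) →
      EnergyCurves.H3Decreasing I (EnergyCurves.Lam I₁ I₂ t) →
      ∀ n : ℕ,
        StrictAntiOn (fun c => EnergyCurves.minimax n (EnergyCurves.Lam I₁ I₂ t c)) I ∧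
        LocallyLipschitzOn I (fun c => EnergyCurves.minimax n (EnergyCurves.Lam I₁ I₂ t c))) ∧
    (EnergyCurves.H2Above I (EnergyCurves.Lam I₁ I₂ t) →
      EnergyCurves.H3Increasing I (EnergyCurves.Lam I₁ I₂ t) →
      ∀ n : ℕ,
        StrictMonoOn (fun c => EnergyCurves.maximin n (EnergyCurves.Lam I₁ I₂ t c)) I ∧
        LocallyLipschitzOn I (fun c => EnergyCurves.maximin n (EnergyCurves.Lam I₁ I₂ t c))) := by
  have hL := EnergyCurves.isSphericalFamily_Lam hI₁ hI₂ hI₁even hI₂even hI₂ne h1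
  refine ⟨fun h2 h3 n => ?_, fun h2 h3 n => ?_⟩
  · exact ⟨hL.strictAntiOn_minimax hdim (fun c hc => (h2 c hc).1) h3 n,
      hL.locallyLipschitzOn_minimax hdim hPSG (fun c hc => (h2 c hc).1) h3 n⟩
  -- The second case is the first for −Λ, which exchanges sup inf with inf sup up to sign.
  · have hbdd : ∀ c ∈ I, BddBelow ((fun u => -EnergyCurves.Lam I₁ I₂ t c u) ''
        EnergyCurves.unitSphere X) := by
      intro c hc
      obtain ⟨b, hb⟩ := (h2 c hc).1
      refine ⟨-b, ?_⟩
      rintro _ ⟨u, hu, rfl⟩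
      exact neg_le_neg (hb (mem_image_of_mem _ hu))
    have hanti := hL.neg.strictAntiOn_minimax hdim hbdd h3.neg n
    have hlip := hL.neg.locallyLipschitzOn_minimax hdim hPSG.neg hbdd h3.neg n
    simp only [EnergyCurves.minimax_neg] at hanti hlip
    refine ⟨fun c hc c' hc' hlt => neg_lt_neg_iff.1 (hanti hc hc' hlt), fun c hc => ?_⟩
    obtain ⟨K, s, hs, hK⟩ := hlip hc
    refine ⟨K, s, hs, fun x hx y hy => ?_⟩
    simpa only [edist_neg_neg] using hK hx hy
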